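/- Let $H$ be a semisimple Hopf algebra over a field $k$ of characteristic $0$, with antipode $S$, counit $\varepsilon$ and linear dual $H^*$, an algebra under the convolution product $\langle pq,h\rangle=\sum\langle p,h_1\rangle\langle q,h_2\rangle$. For $a,a',h\in H$ and $p\in H^*$ put $$\langle a\rightharpoonup p,a'\rangle=\langle p,a'a\rangle,\qquad \langle p\leftharpoonup a,a'\rangle=\langle p,aa'\rangle,\qquad p\rightharpoonup h=\sum h_1\langle p,h_2\rangle,$$ $$h\rightharpoonup_{\mathrm{coad}}p=\sum S(h_2)\rightharpoonup p\leftharpoonup h_1 .$$ Let $N$ be a left coideal subalgebra of $H$, that is, a subalgebra with $\Delta(N)\subseteq H\otimes N$. Then $H$ and $N$ have unique nonzero idempotent two-sided integrals $\Lambda$ and $\Lambda_N$. Let $B=(H^*)^N=\{p\in H^* : n\rightharpoonup p=\varepsilon(n)p\ \ \forall n\in N\}$ and $\lambda_B=\Lambda_N\rightharpoonup\chi_H$, where $\chi_H\in H^*$ is the character of the left regular representation of $H$. Then $\lambda_B$ is a nonzero two-sided integral of $B$ and $\lambda_B\rightharpoonup H\subseteq N$, so that $\gamma:N^*\to H^*$,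 $\langle\gamma(p),h\rangle=\langle p,\lambda_B\rightharpoonup h\rangle$, is well defined. Let $R(N)\subseteq N^*$ be the $k$-span of the characters of the irreducible $N$-modules. There is a unique $k$-linear map $R(N)\to H^*$, $\phi\mapsto\phi^{\uparrow H}$, that sends the character of each irreducible $N$-module $V$ to the character of the induced $H$-module $H\otimes_N V$, and for every $\phi\in R(N)$ $$\phi^{\uparrow H}=\Lambda\rightharpoonup_{\mathrm{coad}}\gamma(\phi).$$ -/

import Mathlib

open scoped TensorProduct

/-! Notation: `H` is a Hopf algebra over the field `k`; `Module.Dual k H` is its linear dual `H^*`,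
with the convolution product `⟨p q, h⟩ = ∑ ⟨p, h₁⟩⟨q, h₂⟩`. -/

namespace HopfInduction

universe u v

section Hopf

variable {k : Type u} {H : Type v} [Field k] [Ring H] [HopfAlgebra k H]

/-- The product of `H^*`: `⟨p q, h⟩ = ∑ ⟨p, h₁⟩⟨q, h₂⟩` (Mathlib's convolution product). -/
noncomputable def dualMul (p q : Module.Dual k H) : Module.Dual k H :=
  (WithConv.toConv p * WithConv.toConv q).ofConv

/-- The left hit action `a ⇀ p` of `H` on `H^*`: `⟨a ⇀ p, a'⟩ = ⟨p, a' a⟩`. -/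
def leftHit (a : H) (p : Module.Dual k H) : Module.Dual k H :=
  p ∘ₗ LinearMap.mulRight k a

/-- The right hit action `p ↼ a` of `H` on `H^*`: `⟨p ↼ a, a'⟩ = ⟨p, a a'⟩`. -/
def rightHit (p : Module.Dual k H) (a : H) : Module.Dual k H :=
  p ∘ₗ LinearMap.mulLeft k a

/-- The left hit action of `H^*` on `H`, as a linear map in `h`: `p ⇀ h = ∑ h₁ ⟨p, h₂⟩`. -/
noncomputable def dualHit (p : Module.Dual k H) : H →ₗ[k] H :=
  (TensorProduct.rid k H).toLinearMap ∘ₗ p.lTensor H ∘ₗ Coalgebra.comul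

/-- The action of `H` on `H^*` dual to the left adjoint action:
`coad h p = ∑ S(h₂) ⇀ p ↼ h₁`. -/
noncomputable def coad (h : H) (p : Module.Dual k H) : Module.Dual k H :=
  TensorProduct.lift
    (LinearMap.mk₂ k
      (fun a b : H => leftHit (HopfAlgebra.antipode k b) (rightHit p a))
      (fun a a' b => by ext x; simp [leftHit, rightHit, add_mul])
      (fun c a b => by ext x; simp [leftHit, rightHit])
      (fun a b b' => by ext x; simp [leftHit, rightHit, mul_add])
      (fun c a b => by ext x; simp [leftHit, rightHit]))
    (Coalgebra.comul (R := k) h)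

/-- A left coideal subalgebra: a subalgebra `N` with `Δ(N) ⊆ H ⊗ N`. -/
def IsLeftCoideal (N : Subalgebra k H) : Prop :=
  ∀ n ∈ N, Coalgebra.comul (R := k) n ∈ LinearMap.range (N.val.toLinearMap.lTensor H)

/-- `Λ` is a (nonzero) idempotent two-sided integral of the augmented subalgebra `N`. -/
structure IsIdempotentIntegral (N : Subalgebra k H) (Λ : H) : Prop where
  mem : Λ ∈ N
  ne_zero : Λ ≠ 0
  idem : Λ * Λ = Λ
  left : ∀ n ∈ N, n * Λ = Coalgebra.counit (R := k) n • Λ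
  right : ∀ n ∈ N, Λ * n = Coalgebra.counit (R := k) n • Λ

/-- `B = (H^*)^N`, the invariants of `H^*` under the left hit action of `N`. -/
def dualInvariants (N : Subalgebra k H) : Submodule k (Module.Dual k H) where
  carrier := {p | ∀ n ∈ N, leftHit n p = Coalgebra.counit (R := k) n • p}
  add_mem' := fun {p q} hp hq n hn => by
    have h1 := hp n hn
    have h2 := hq n hn
    simp only [leftHit, LinearMap.add_comp, smul_add] at *
    rw [h1, h2]
  zero_mem' := fun n _ => by simp [leftHit]
  smul_mem' := fun c p hp n hn => by
    have h1 := hp n hn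
    simp only [leftHit, LinearMap.smul_comp] at *
    rw [h1, smul_comm]

/-- `b₀` is a nonzero two-sided integral of `B ⊆ H^*` (the augmentation of `H^*` is
evaluation at `1`). -/
structure IsDualIntegral (B : Submodule k (Module.Dual k H)) (b₀ : Module.Dual k H) : Prop where
  mem : b₀ ∈ B
  ne_zero : b₀ ≠ 0
  left : ∀ b ∈ B, dualMul b b₀ = b 1 • b₀
  right : ∀ b ∈ B, dualMul b₀ b = b 1 • b₀

/-- `γ : N^* → H^*`, `⟨γ(p), h⟩ = ⟨p, l ⇀ h⟩`, for `l ∈ H^*` with `l ⇀ H ⊆ N`. -/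
noncomputable def gamma (N : Subalgebra k H) (l : Module.Dual k H) (hl : ∀ h, dualHit l h ∈ N) :
    Module.Dual k N →ₗ[k] Module.Dual k H :=
  Module.Dual.transpose (R := k)
    ((dualHit l).codRestrict (Subalgebra.toSubmodule N) hl : H →ₗ[k] N)

end Hopf

section Characters

variable (k : Type u) [Field k]

/-- The character `a ↦ tr (a | V)` of an `A`-module `V`. -/
noncomputable def character (A : Type*) [Ring A] [Algebra k A] (V : Type*) [AddCommGroup V]
    [Module k V] [Module A V] [IsScalarTower k A V] : Module.Dual k A :=
  LinearMap.trace k V ∘ₗ (Algebra.lsmul k k V : A →ₐ[k] Module.End k V).toLinearMap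

variable {k} {H : Type v} [Ring H] [Algebra k H]

/-- The relations `h n ⊗ v = h ⊗ n v` in `H ⊗ₖ V` that define `H ⊗_N V`. -/
def inducedRelations (N : Subalgebra k H) (V : Type v) [AddCommGroup V] [Module k V] [Module N V] :
    Submodule H (H ⊗[k] V) :=
  Submodule.span H
    {t | ∃ (h : H) (n : N) (v : V), t = (h * (n : H)) ⊗ₜ[k] v - h ⊗ₜ[k] (n • v)}

/-- The induced `H`-module `H ⊗_N V`. -/
abbrev InducedModule (N : Subalgebra k H) (V : Type v) [AddCommGroup V] [Module k V]
    [Module N V] : Type v :=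
  (H ⊗[k] V) ⧸ inducedRelations N V

/-- `R(N)`, the `k`-span in `N^*` of the characters of the irreducible `N`-modules. -/
def charSpan (N : Subalgebra k H) : Submodule k (Module.Dual k N) :=
  Submodule.span k
    {φ | ∃ (V : Type v) (_ : AddCommGroup V) (_ : Module k V) (_ : Module N V)
      (_ : IsScalarTower k N V) (_ : IsSimpleModule N V), φ = character k N V}

theorem character_mem_charSpan (N : Subalgebra k H) (V : Type v) [i₁ : AddCommGroup V]
    [i₂ : Module k V] [i₃ : Module N V] [i₄ : IsScalarTower k N V] [i₅ : IsSimpleModule N V] :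
    character k N V ∈ charSpan N :=
  Submodule.subset_span ⟨V, i₁, i₂, i₃, i₄, i₅, rfl⟩

/-- `ind : R(N) → H^*` is the linear extension of induction of irreducible characters:
it sends the character of every irreducible `V` to the character of `H ⊗_N V`. -/
def IsCharacterInduction (N : Subalgebra k H) (ind : charSpan N →ₗ[k] Module.Dual k H) : Prop :=
  ∀ (V : Type v) [AddCommGroup V] [Module k V] [Module N V] [IsScalarTower k N V]
    [IsSimpleModule N V],
    ind ⟨character k N V, character_mem_charSpan N V⟩ = character k H (InducedModule N V)

end Characters

end HopfInduction

/-! Write χ for the regular character, t for the idempotent integral of H and ad for the left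
adjoint action. Everything rests on χ being a symmetric Frobenius form with ∑ h₁ χ(h₂) = χ(h) 1 = ∑
χ(h₁) h₂, which needs S² = 1 (Larson–Radford). The functional λ(h) = tr(x ↦ h S²(x)),
`twistedTrace`, satisfies the first identity in any finite-dimensional H, and given t it is a
Frobenius form with Nakayama automorphism S². This yields Radford's formula g S⁴(y) = y g with g
group-like of finite order. In characteristic 0, S² is conjugation by some a with a central power,
and tr S² = λ(1) is a sum of squared moduli, not all zero (`trace_conj_ne_zero`). Hence g = 1 and S⁴
= 1, and integrality of multiplicities (`eq_one_of_trace_eq`) gives S² = 1, so λ = χ.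

The form χ(xy) stays nondegenerate on a left coideal subalgebra N
(`IsLeftCoideal.eq_zero_of_forall_character`). The element of N representing ε is then an integral,
and h ↦ λ_B ⇀ h is χ(Λ_N) times the orthogonal projection H → N (`dualHit_leftHit_integral_eq`).

For dual bases bᵢ, dᵢ of N, the endomorphism h ⊗ v ↦ χ(Λ_N) ∑ h dᵢ ⊗ bᵢ v splits H ⊗ V → H ⊗_N V.
The induced character at x is therefore χ(Λ_N) ∑ tr(h ↦ x h dᵢ) χ_V(bᵢ). Since tr(z ↦ x z y) =
χ(ad(t)(x) y), by `trace_mulLeft_comp_mulRight`, this is χ_V(λ_B ⇀ ad(t)(x)), and the coadjoint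
action is the transpose of ad. -/

open scoped TensorProduct

namespace HopfInduction

universe u v

open Coalgebra HopfAlgebra LinearMap WithConv

/-! ### Convolution calculus and hit actions -/

section Convolution

variable {k : Type u} {H : Type v} [Field k] [Ring H] [HopfAlgebra k H]
variable {A : Type*} [Ring A] [Algebra k A]

/-- The convolution product of linear maps `H → A`: `h ↦ ∑ f(h₁) g(h₂)`. -/
noncomputable def conv (f g : H →ₗ[k] A) : H →ₗ[k] A :=
  mul' k A ∘ₗ TensorProduct.map f g ∘ₗ comul

/-- The right hit action of `H^*` on `H`: `h ↼ p = ∑ ⟨p, h₁⟩ h₂`. -/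
noncomputable def dualHitRight (p : Module.Dual k H) : H →ₗ[k] H :=
  (TensorProduct.lid k H).toLinearMap ∘ₗ p.rTensor H ∘ₗ comul

/-- A functional viewed as a map to an algebra with scalar values. -/
noncomputable def scalarMap (A : Type*) [Ring A] [Algebra k A] (p : Module.Dual k H) :
    H →ₗ[k] A :=
  Algebra.linearMap k A ∘ₗ p

@[simp] theorem scalarMap_apply (p : Module.Dual k H) (h : H) :
    scalarMap A p h = algebraMap k A (p h) := rfl

theorem conv_repr (f g : H →ₗ[k] A) {h : H} {ι : Type*} (r : Coalgebra.Repr k h ι) :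
    conv f g h = ∑ i ∈ r.index, f (r.left i) * g (r.right i) := by
  simp [conv, ← r.eq]

theorem dualHit_repr (p : Module.Dual k H) {h : H} {ι : Type*} (r : Coalgebra.Repr k h ι) :
    dualHit p h = ∑ i ∈ r.index, p (r.right i) • r.left i := by
  simp [dualHit, ← r.eq]

theorem dualHitRight_repr (p : Module.Dual k H) {h : H} {ι : Type*} (r : Coalgebra.Repr k h ι) :
    dualHitRight p h = ∑ i ∈ r.index, p (r.left i) • r.right i := by
  simp [dualHitRight, ← r.eq]

theorem dualMul_repr (p q : Module.Dual k H) {h : H} {ι : Type*} (r : Coalgebra.Repr k h ι) :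
    dualMul p q h = ∑ i ∈ r.index, p (r.left i) * q (r.right i) := by
  have : dualMul p q h = (toConv p * toConv q) h := rfl
  rw [this, r.convMul_apply]

theorem conv_assoc (f g l : H →ₗ[k] A) : conv (conv f g) l = conv f (conv g l) := by
  have := mul_assoc (toConv f) (toConv g) (toConv l)
  exact congrArg ofConv this

theorem conv_scalarMap (f : H →ₗ[k] A) (p : Module.Dual k H) :
    conv f (scalarMap A p) = f ∘ₗ dualHit p := by
  ext h
  simp [conv_repr _ _ (ℛ k h), dualHit_repr _ (ℛ k h), Algebra.algebraMap_eq_smul_one]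

theorem scalarMap_conv (f : H →ₗ[k] A) (p : Module.Dual k H) :
    conv (scalarMap A p) f = f ∘ₗ dualHitRight p := by
  ext h
  simp [conv_repr _ _ (ℛ k h), dualHitRight_repr _ (ℛ k h), Algebra.algebraMap_eq_smul_one]

theorem conv_smulRight (f : H →ₗ[k] A) (p : Module.Dual k H) (w : A) :
    conv f (p.smulRight w) = mulRight k w ∘ₗ f ∘ₗ dualHit p := by
  ext h
  simp [conv_repr _ _ (ℛ k h), dualHit_repr _ (ℛ k h)]

@[simp] theorem dualHit_counit : dualHit (counit : Module.Dual k H) = LinearMap.id := by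
  ext h
  simp [dualHit, Coalgebra.lTensor_counit_comul]

@[simp] theorem dualHitRight_counit : dualHitRight (counit : Module.Dual k H) = LinearMap.id := by
  ext h
  simp [dualHitRight, Coalgebra.rTensor_counit_comul]

theorem conv_antipode_id : conv (antipode k) (LinearMap.id : H →ₗ[k] H) = scalarMap H counit := by
  ext h
  simp [conv_repr _ _ (ℛ k h), sum_antipode_mul_eq_algebraMap_counit]

theorem conv_id_antipode : conv (LinearMap.id : H →ₗ[k] H) (antipode k) = scalarMap H counit := by
  ext h
  simp [conv_repr _ _ (ℛ k h), sum_mul_antipode_eq_algebraMap_counit]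

theorem conv_counit (f : H →ₗ[k] A) : conv f (scalarMap A counit) = f := by
  rw [conv_scalarMap, dualHit_counit, comp_id]

theorem counit_conv (f : H →ₗ[k] A) : conv (scalarMap A counit) f = f := by
  rw [scalarMap_conv, dualHitRight_counit, comp_id]

theorem antipode_conv_id_conv (G : H →ₗ[k] H) : conv (antipode k) (conv LinearMap.id G) = G := by
  rw [← conv_assoc, conv_antipode_id, counit_conv]

theorem id_conv_antipode_conv (G : H →ₗ[k] H) : conv LinearMap.id (conv (antipode k) G) = G := by
  rw [← conv_assoc, conv_id_antipode, counit_conv]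

theorem conv_id_conv_antipode (G : H →ₗ[k] H) : conv (conv G LinearMap.id) (antipode k) = G := by
  rw [conv_assoc, conv_id_antipode, conv_counit]

theorem algHom_comp_conv {B : Type*} [Ring B] [Algebra k B] (F : A →ₐ[k] B) (f g : H →ₗ[k] A) :
    F.toLinearMap ∘ₗ conv f g = conv (F.toLinearMap ∘ₗ f) (F.toLinearMap ∘ₗ g) := by
  ext h
  simp [conv_repr _ _ (ℛ k h)]

theorem algHom_comp_scalarMap {B : Type*} [Ring B] [Algebra k B] (F : A →ₐ[k] B)
    (p : Module.Dual k H) : F.toLinearMap ∘ₗ scalarMap A p = scalarMap B p := by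
  ext h
  simp

theorem dualMul_apply (p q : Module.Dual k H) (h : H) : dualMul p q h = p (dualHit q h) := by
  simp [dualMul_repr _ _ (ℛ k h), dualHit_repr _ (ℛ k h), mul_comm]

theorem dualMul_apply' (p q : Module.Dual k H) (h : H) : dualMul p q h = q (dualHitRight p h) := by
  simp [dualMul_repr _ _ (ℛ k h), dualHitRight_repr _ (ℛ k h)]

theorem conv_scalarMap_scalarMap (p q : Module.Dual k H) :
    conv (scalarMap A p) (scalarMap A q) = scalarMap A (dualMul p q) := by
  ext h
  rw [conv_scalarMap]
  simp [dualMul_apply]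

theorem dualHit_eq_conv (p : Module.Dual k H) : dualHit p = conv LinearMap.id (scalarMap H p) := by
  rw [conv_scalarMap, id_comp]

theorem dualHit_comp_dualHit (p q : Module.Dual k H) :
    dualHit p ∘ₗ dualHit q = dualHit (dualMul p q) := by
  rw [← conv_scalarMap, dualHit_eq_conv, conv_assoc, conv_scalarMap_scalarMap, dualHit_eq_conv]

theorem algHom_conv_antipode (F : H →ₐ[k] A) :
    conv F.toLinearMap (F.toLinearMap ∘ₗ antipode k) = scalarMap A counit := by
  have := congrArg (F.toLinearMap ∘ₗ ·) (conv_id_antipode (k := k) (H := H))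
  simpa only [algHom_comp_conv, algHom_comp_scalarMap, comp_id] using this

theorem antipode_conv_algHom (F : H →ₐ[k] A) :
    conv (F.toLinearMap ∘ₗ antipode k) F.toLinearMap = scalarMap A counit := by
  have := congrArg (F.toLinearMap ∘ₗ ·) (conv_antipode_id (k := k) (H := H))
  simpa only [algHom_comp_conv, algHom_comp_scalarMap, comp_id] using this

theorem comulAlgHom_eq_conv : (Bialgebra.comulAlgHom k H).toLinearMap =
    conv (Algebra.TensorProduct.includeLeft : H →ₐ[k] H ⊗[k] H).toLinearMap
      (Algebra.TensorProduct.includeRight : H →ₐ[k] H ⊗[k] H).toLinearMap := by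
  ext h
  simp [conv_repr _ _ (ℛ k h), (ℛ k h).eq]

/-- Both sides are convolution inverses of Δ : H → H ⊗ H: `h₁` makes Δ ∘ S a left inverse, and `h₂`
makes the flipped S ⊗ S a right inverse. -/
theorem comul_antipode (h : H) : comul (R := k) (antipode k h) =
    TensorProduct.comm k H H (TensorProduct.map (antipode k) (antipode k) (comul (R := k) h)) := by
  let i₁ : H →ₐ[k] H ⊗[k] H := Algebra.TensorProduct.includeLeft
  let i₂ : H →ₐ[k] H ⊗[k] H := Algebra.TensorProduct.includeRight
  let D : H →ₐ[k] H ⊗[k] H := Bialgebra.comulAlgHom k H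
  have hD : D.toLinearMap = conv i₁.toLinearMap i₂.toLinearMap := comulAlgHom_eq_conv
  have h₁ := antipode_conv_algHom D
  have e₁ := algHom_conv_antipode i₁
  have e₂ := algHom_conv_antipode i₂
  have h₂ : conv D.toLinearMap (conv (i₂.toLinearMap ∘ₗ antipode k) (i₁.toLinearMap ∘ₗ antipode k))
      = scalarMap _ counit := by
    rw [hD, conv_assoc, ← conv_assoc i₂.toLinearMap, e₂, counit_conv, e₁]
  have h₃ : D.toLinearMap ∘ₗ antipode k =
      conv (i₂.toLinearMap ∘ₗ antipode k) (i₁.toLinearMap ∘ₗ antipode k) := by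
    rw [← conv_counit (D.toLinearMap ∘ₗ antipode k), ← h₂, ← conv_assoc, h₁, counit_conv]
  have h₄ := LinearMap.congr_fun h₃ h
  rw [conv_repr _ _ (ℛ k h)] at h₄
  rw [← (ℛ k h).eq]
  simpa [D, i₁, i₂] using h₄

theorem dualHit_antipode (p : Module.Dual k H) (h : H) :
    dualHit p (antipode k h) = antipode k (dualHitRight (p ∘ₗ antipode k) h) := by
  rw [dualHit]
  simp only [comp_apply, comul_antipode]
  rw [dualHitRight_repr _ (ℛ k h), ← (ℛ k h).eq]
  simp

theorem dualHitRight_antipode (p : Module.Dual k H) (h : H) :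
    dualHitRight p (antipode k h) = antipode k (dualHit (p ∘ₗ antipode k) h) := by
  rw [dualHitRight]
  simp only [comp_apply, comul_antipode]
  rw [dualHit_repr _ (ℛ k h), ← (ℛ k h).eq]
  simp

theorem antipode_mul (a b : H) : antipode k (a * b) = antipode k b * antipode k a :=
  antipode_mul_antidistrib a b

@[simp] theorem leftHit_apply (a : H) (p : Module.Dual k H) (x : H) : leftHit a p x = p (x * a) :=
  rfl

@[simp] theorem rightHit_apply (a : H) (p : Module.Dual k H) (x : H) :
    rightHit p a x = p (a * x) := rfl

theorem dualHit_mul (p : Module.Dual k H) (x y : H) {ι : Type*} (r : Coalgebra.Repr k y ι) :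
    dualHit p (x * y) = ∑ j ∈ r.index, dualHit (leftHit (r.right j) p) x * r.left j := by
  simp only [dualHit, comp_apply, Bialgebra.comul_mul]
  rw [← r.eq, ← (ℛ k x).eq, Finset.sum_mul_sum, Finset.sum_comm]
  simp [Finset.sum_mul]

theorem dualHitRight_mul (p : Module.Dual k H) (x y : H) {ι : Type*} (r : Coalgebra.Repr k x ι) :
    dualHitRight p (x * y) = ∑ i ∈ r.index, r.right i * dualHitRight (rightHit p (r.left i)) y := by
  simp only [dualHitRight, comp_apply, Bialgebra.comul_mul]
  rw [← r.eq, ← (ℛ k y).eq, Finset.sum_mul_sum]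
  simp [Finset.mul_sum]

/-- If `∑ x₁ p(x₂) = p(x) 1` for all `x`, then `∑ S(x₁) p(x₂ y) = ∑ y₁ p(x y₂)`. -/
theorem antipode_dualHit_leftHit {p : Module.Dual k H} (hp : dualHit p = scalarMap H p) (x y : H) :
    antipode k (dualHit (leftHit y p) x) = dualHit (rightHit p x) y := by
  let r := ℛ k y
  let G : H →ₗ[k] H := ∑ j ∈ r.index, (leftHit (r.right j) p).smulRight (r.left j)
  -- The left side at v is ∑ v₁ y₁ p(v₂ y₂) = p ⇀ (v y), a scalar by `hp`; convolving with S on the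
  -- left then isolates G.
  have hG : conv LinearMap.id G = scalarMap H (leftHit y p) := by
    ext v
    have := dualHit_mul p v y r
    rw [hp] at this
    rw [scalarMap_apply, leftHit_apply, ← scalarMap_apply (A := H), this, conv_repr _ _ (ℛ k v)]
    simp only [G, dualHit_repr _ (ℛ k v), Finset.sum_mul, LinearMap.sum_apply, Finset.mul_sum]
    rw [Finset.sum_comm]
    simp
  have h₁ := antipode_conv_id_conv G
  rw [hG, conv_scalarMap] at h₁
  have h₂ := LinearMap.congr_fun h₁ x
  rw [comp_apply] at h₂
  rw [h₂, dualHit_repr _ r]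
  simp [G]

/-- If `∑ p(x₁) x₂ = p(x) 1` for all `x`, then `∑ p(x₁ y) x₂ = ∑ p(x y₁) S(y₂)`. -/
theorem antipode_dualHitRight_rightHit {p : Module.Dual k H}
    (hp : dualHitRight p = scalarMap H p) (x y : H) :
    antipode k (dualHitRight (rightHit p x) y) = dualHitRight (leftHit y p) x := by
  let r := ℛ k x
  let G : H →ₗ[k] H := ∑ j ∈ r.index, (rightHit p (r.left j)).smulRight (r.right j)
  have hG : conv G LinearMap.id = scalarMap H (rightHit p x) := by
    ext v
    have := dualHitRight_mul p x v r
    rw [hp] at this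
    rw [scalarMap_apply, rightHit_apply, ← scalarMap_apply (A := H), this, conv_repr _ _ (ℛ k v)]
    simp only [G, dualHitRight_repr _ (ℛ k v), Finset.sum_mul, LinearMap.sum_apply, Finset.mul_sum]
    rw [Finset.sum_comm]
    simp
  have h₁ := conv_id_conv_antipode G
  rw [hG, scalarMap_conv] at h₁
  have h₂ := LinearMap.congr_fun h₁ y
  rw [comp_apply] at h₂
  rw [h₂, dualHitRight_repr _ r]
  simp [G]

end Convolution

/-! ### Separability idempotents -/

section Separable

/-- `e` is a separability idempotent of the `k`-algebra `A`. -/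
structure IsSeparabilityIdempotent (k : Type*) {A : Type*} [Field k] [Ring A] [Algebra k A]
    (e : A ⊗[k] A) : Prop where
  mul_eq_one : mul' k A e = 1
  comm : ∀ x : A, (mulLeft k x).rTensor A e = (mulRight k x).lTensor A e

variable {k : Type*} {A : Type*} [Field k] [Ring A] [Algebra k A]

theorem tensor_eq_of_forall_dual {M N : Type*} [AddCommGroup M] [Module k M] [AddCommGroup N]
    [Module k N] {s t : M ⊗[k] N}
    (h : ∀ f : Module.Dual k N, TensorProduct.rid k M (f.lTensor M s) =
      TensorProduct.rid k M (f.lTensor M t)) : s = t := by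
  classical
  let b := Module.Basis.ofVectorSpace k N
  apply (TensorProduct.equivFinsuppOfBasisRight (M := M) b).injective
  have key : ∀ (z : M ⊗[k] N) i, TensorProduct.equivFinsuppOfBasisRight b z i =
      TensorProduct.rid k M ((b.coord i).lTensor M z) := by
    intro z i
    induction z with
    | zero => simp
    | add x y hx hy => simp only [map_add, Finsupp.add_apply, hx, hy]
    | tmul m n => simp
  ext i
  rw [key, key, h]

theorem IsSeparabilityIdempotent.sum_comm {e : A ⊗[k] A} (he : IsSeparabilityIdempotent k e)
    {s : Finset (A × A)} (hs : e = ∑ i ∈ s, i.1 ⊗ₜ[k] i.2) {M : Type*} [AddCommGroup M] [Module k M]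
    (f : A →ₗ[k] A →ₗ[k] M) (x : A) :
    ∑ i ∈ s, f (x * i.1) i.2 = ∑ i ∈ s, f i.1 (i.2 * x) := by
  have := congrArg (TensorProduct.lift f) (he.comm x)
  simpa [hs] using this

/-- Write e = ∑ mᵢ ⊗ bᵢ. Comparing coordinates in `he.comm` expresses each x mᵢ through the mⱼ; as 1
= ∑ mᵢ bᵢ, the finitely many products mⱼ bᵢ span A. -/
theorem IsSeparabilityIdempotent.finite {e : A ⊗[k] A} (he : IsSeparabilityIdempotent k e) :
    Module.Finite k A := by
  classical
  let b := Module.Basis.ofVectorSpace k A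
  obtain ⟨m, hm⟩ := TensorProduct.eq_repr_basis_right b e
  have h₁ : ∀ x i, x * m i = ∑ j ∈ m.support, b.coord i (b j * x) • m j := by
    intro x i
    have := congrArg (TensorProduct.rid k A ∘ (b.coord i).lTensor A) (he.comm x)
    simp only [← hm, Finsupp.sum, map_sum, rTensor_tmul, lTensor_tmul, Function.comp_apply,
      TensorProduct.rid_tmul, mulLeft_apply, mulRight_apply] at this
    rw [← this]
    by_cases hi : i ∈ m.support
    · rw [Finset.sum_eq_single_of_mem i hi]
      · simp
      · intro j _ hj
        simp [hj]
    · rw [Finset.sum_eq_zero]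
      · rw [Finsupp.notMem_support_iff.mp hi, mul_zero]
      · intro j hj
        have : j ≠ i := by rintro rfl; exact hi hj
        simp [this]
  refine ⟨⟨(m.support ×ˢ m.support).image fun p => m p.1 * b p.2, ?_⟩⟩
  rw [eq_top_iff]
  intro x _
  have h₂ : ∑ i ∈ m.support, m i * b i = 1 := by
    have := he.mul_eq_one
    simpa [← hm, Finsupp.sum] using this
  rw [← mul_one x, ← h₂, Finset.mul_sum]
  refine Submodule.sum_mem _ fun i hi => ?_
  rw [← mul_assoc, h₁, Finset.sum_mul]
  refine Submodule.sum_mem _ fun j hj => ?_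
  rw [smul_mul_assoc]
  refine Submodule.smul_mem _ _ (Submodule.subset_span ?_)
  rw [Finset.mem_coe, Finset.mem_image]
  exact ⟨(j, i), by simp [hi, hj], rfl⟩

/-- Maschke's argument: a k-linear retraction onto a left ideal becomes A-linear after averaging
over e. -/
theorem IsSeparabilityIdempotent.isSemisimpleRing {e : A ⊗[k] A}
    (he : IsSeparabilityIdempotent k e) : IsSemisimpleRing A := by
  classical
  obtain ⟨s, hs⟩ := TensorProduct.exists_finset e
  have hone : ∑ i ∈ s, i.1 * i.2 = 1 := by
    have := he.mul_eq_one
    simpa [hs] using this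
  have hcompl : ∀ I : Submodule A A, ∃ J, IsCompl I J := by
    intro I
    obtain ⟨π, hπ⟩ := LinearMap.exists_leftInverse_of_injective (I.restrictScalars k).subtype
      (Submodule.ker_subtype _)
    have hπ' : ∀ x (hx : x ∈ I), (π x : A) = x := fun x hx =>
      congrArg Subtype.val (LinearMap.congr_fun hπ ⟨x, hx⟩)
    let P : A →ₗ[A] I :=
      { toFun := fun y => ∑ i ∈ s, (⟨i.1 * (π (i.2 * y) : A), I.smul_mem i.1 (π (i.2 * y)).2⟩ : I)
        map_add' := fun x y => by
          apply Subtype.ext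
          simp [mul_add, Finset.sum_add_distrib]
        map_smul' := fun x y => by
          apply Subtype.ext
          have := he.sum_comm hs ((LinearMap.mul k A).compl₂
            ((I.restrictScalars k).subtype ∘ₗ π ∘ₗ mulRight k y)) x
          simp only [compl₂_apply, LinearMap.mul_apply', comp_apply, mulRight_apply,
            Submodule.subtype_apply] at this
          simp only [smul_eq_mul, AddSubmonoidClass.coe_finsetSum, RingHom.id_apply,
            SetLike.val_smul, Finset.mul_sum, ← mul_assoc]
          exact this.symm }
    refine ⟨ker P, LinearMap.isCompl_of_proj fun x => Subtype.ext ?_⟩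
    have hx : ∀ i : A × A, (π (i.2 * x) : A) = i.2 * x := fun i => hπ' _ (I.smul_mem i.2 x.2)
    change ((∑ i ∈ s, (⟨i.1 * (π (i.2 * x) : A), _⟩ : I) : I) : A) = x
    simp only [AddSubmonoidClass.coe_finsetSum, hx, ← mul_assoc, ← Finset.sum_mul, hone, one_mul]
  exact (isSemisimpleModule_iff _ _).mpr ⟨hcompl⟩

theorem IsSeparabilityIdempotent.baseChange {e : A ⊗[k] A}
    (he : IsSeparabilityIdempotent k e) (K : Type*) [Field K] [Algebra k K] :
    ∃ e' : (K ⊗[k] A) ⊗[K] (K ⊗[k] A), IsSeparabilityIdempotent K e' := by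
  classical
  obtain ⟨s, hs⟩ := TensorProduct.exists_finset e
  refine ⟨∑ i ∈ s, ((1 : K) ⊗ₜ[k] i.1) ⊗ₜ[K] ((1 : K) ⊗ₜ[k] i.2), ⟨?_, ?_⟩⟩
  · have := he.mul_eq_one
    simp only [hs, map_sum, mul'_apply] at this
    simp [← TensorProduct.tmul_sum, this, Algebra.TensorProduct.one_def]
  · intro x
    induction x with
    | zero => simp
    | add x y hx hy =>
      have h₁ : mulLeft K (x + y) = mulLeft K x + mulLeft K y := by
        apply LinearMap.ext; intro; simp [add_mul]
      have h₂ : mulRight K (x + y) = mulRight K x + mulRight K y := by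
        apply LinearMap.ext; intro; simp [mul_add]
      rw [h₁, h₂, rTensor_add, lTensor_add, LinearMap.add_apply, LinearMap.add_apply, hx, hy]
    | tmul c x =>
      let j : A →ₗ[k] K ⊗[k] A := TensorProduct.mk k K A 1
      let f : A →ₗ[k] A →ₗ[k] (K ⊗[k] A) ⊗[K] (K ⊗[k] A) :=
        (((TensorProduct.mk K (K ⊗[k] A) (K ⊗[k] A)).restrictScalars₁₂ k k).compl₁₂ j j)
      have := congrArg (c • ·) (he.sum_comm hs f x)
      have hc : ∀ a b : A, ((1 : K) ⊗ₜ[k] a) ⊗ₜ[K] (c ⊗ₜ[k] b) =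
          (c ⊗ₜ[k] a) ⊗ₜ[K] ((1 : K) ⊗ₜ[k] b) := fun a b => by
        have h : ∀ z : A, c ⊗ₜ[k] z = c • ((1 : K) ⊗ₜ[k] z) := fun z => by
          rw [TensorProduct.smul_tmul', smul_eq_mul, mul_one]
        rw [h a, h b, TensorProduct.smul_tmul]
      simpa [f, j, Finset.smul_sum, TensorProduct.smul_tmul', hc] using this

end Separable

/-! ### Integrals of a semisimple Hopf algebra -/

section Integral

/-- Split R = ker f ⊕ J as left ideals and let t be the J-component of 1: if f(x) = 0, then x t lies
in both summands. For f = ε this is a left integral. -/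
theorem exists_mul_eq_zero_of_ringHom {R K : Type*} [Ring R] [IsSemisimpleRing R] [Ring K]
    (f : R →+* K) : ∃ t : R, f t = 1 ∧ ∀ x, f x = 0 → x * t = 0 := by
  obtain ⟨J, hJ⟩ := exists_isCompl (RingHom.ker f : Submodule R R)
  have h1 : (1 : R) ∈ (RingHom.ker f : Submodule R R) ⊔ J := by
    rw [hJ.sup_eq_top]; trivial
  obtain ⟨e, he, t, ht, het⟩ := Submodule.mem_sup.mp h1
  refine ⟨t, ?_, fun x hx => ?_⟩
  · have := congrArg f het
    rwa [map_add, RingHom.mem_ker.mp he, zero_add, map_one] at this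
  · have h₁ : x * t ∈ (RingHom.ker f : Submodule R R) := by
      change f (x * t) = 0
      rw [map_mul, hx, zero_mul]
    have h₂ : x * t ∈ J := J.smul_mem x ht
    exact (Submodule.disjoint_def.mp hJ.disjoint) _ h₁ h₂

variable {k : Type u} {H : Type v} [Field k] [Ring H] [HopfAlgebra k H]

theorem IsIdempotentIntegral.counit_eq_one {N : Subalgebra k H} {t : H}
    (ht : IsIdempotentIntegral N t) : counit (R := k) t = 1 := by
  have h := ht.left t ht.mem
  rw [ht.idem] at h
  have h' : (counit (R := k) t - 1) • t = 0 := by rw [sub_smul, ← h, one_smul, sub_self]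
  exact sub_eq_zero.mp ((smul_eq_zero.mp h').resolve_right ht.ne_zero)

theorem IsIdempotentIntegral.unique {N : Subalgebra k H} {s t : H}
    (hs : IsIdempotentIntegral N s) (ht : IsIdempotentIntegral N t) : s = t := by
  have h₁ := hs.right t ht.mem
  have h₂ := ht.left s hs.mem
  rw [ht.counit_eq_one, one_smul] at h₁
  rw [hs.counit_eq_one, one_smul] at h₂
  rw [← h₁, h₂]

variable (k H) in
theorem exists_isIdempotentIntegral_top [IsSemisimpleRing H] :
    ∃ t : H, IsIdempotentIntegral (⊤ : Subalgebra k H) t := by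
  obtain ⟨t, ht, ht0⟩ := exists_mul_eq_zero_of_ringHom (Bialgebra.counitAlgHom k H).toRingHom
  -- The opposite ring gives a right integral; it equals the left one because ε takes the value 1 on
  -- both.
  obtain ⟨s, hs, hs0⟩ := exists_mul_eq_zero_of_ringHom
    ((Bialgebra.counitAlgHom k H).toRingHom.fromOpposite fun _ _ => mul_comm _ _)
  have hl : ∀ x, x * t = counit (R := k) x • t := by
    intro x
    have := ht0 (x - algebraMap k H (counit x)) (by simp)
    rw [sub_mul, sub_eq_zero] at this
    rw [this, Algebra.smul_def]
  have hr : ∀ x, s.unop * x = counit (R := k) x • s.unop := by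
    intro x
    have := hs0 (MulOpposite.op (x - algebraMap k H (counit x))) (by simp)
    have := congrArg MulOpposite.unop this
    rw [MulOpposite.unop_mul, MulOpposite.unop_op, mul_sub, MulOpposite.unop_zero, sub_eq_zero]
      at this
    rw [this, Algebra.smul_def, Algebra.commutes]
  have ht' : counit (R := k) t = 1 := ht
  have hs' : counit (R := k) s.unop = 1 := hs
  have hst : s.unop = t := by
    have h₁ := hl s.unop
    have h₂ := hr t
    rw [hs', one_smul] at h₁
    rw [ht', one_smul] at h₂
    rw [← h₂, h₁]
  refine ⟨t, trivial, ?_, ?_, fun n _ => hl n, fun n _ => ?_⟩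
  · rintro rfl
    simp at ht'
  · rw [hl, ht', one_smul]
  · rw [← hst, hr]

/-- For G(x) = ∑ S(t₁) f(t₂ x), the integral property collapses S * G to x ↦ ε(x) S(f ⇀ t), and
convolving with the identity recovers G. Letting f vary, this is the invariance of ∑ S(t₁) ⊗ t₂. -/
theorem mul_antipode_dualHit_integral {t : H} (ht : IsIdempotentIntegral (⊤ : Subalgebra k H) t)
    (f : Module.Dual k H) (x : H) :
    antipode k (dualHit (leftHit x f) t) = x * antipode k (dualHit f t) := by
  let r := ℛ k t
  let w := antipode k (dualHit f t)
  let G : H →ₗ[k] H := ∑ i ∈ r.index, (rightHit f (r.right i)).smulRight (antipode k (r.left i))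
  have hG : ∀ x, G x = antipode k (dualHit (leftHit x f) t) := by
    intro x
    simp [G, dualHit_repr _ r]
  have h₁ : conv (antipode k) G = (counit : Module.Dual k H).smulRight w := by
    ext x
    have h := dualHit_mul f t x (ℛ k x)
    rw [ht.right x trivial, map_smul] at h
    have h := congrArg (antipode k) h
    rw [map_smul, map_sum] at h
    simp only [antipode_mul] at h
    rw [conv_repr _ _ (ℛ k x), smulRight_apply, h]
    simp only [hG]
  have h₂ := id_conv_antipode_conv G
  have h₃ : conv LinearMap.id ((counit : Module.Dual k H).smulRight w) = mulRight k w := by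
    rw [conv_smulRight, dualHit_counit, comp_id, comp_id]
  rw [h₁, h₃] at h₂
  rw [← hG, ← h₂, mulRight_apply]

theorem isSeparabilityIdempotent_integral {t : H}
    (ht : IsIdempotentIntegral (⊤ : Subalgebra k H) t) :
    IsSeparabilityIdempotent k ((antipode k).rTensor H (comul (R := k) t)) := by
  have key : ∀ (f : Module.Dual k H) x, TensorProduct.rid k H (f.lTensor H ((mulRight k x).lTensor H
      ((antipode k).rTensor H (comul (R := k) t)))) = antipode k (dualHit (leftHit x f) t) := by
    intro f x
    rw [dualHit_repr _ (ℛ k t), ← (ℛ k t).eq]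
    simp
  refine ⟨?_, fun x => tensor_eq_of_forall_dual fun f => ?_⟩
  · rw [mul_antipode_rTensor_comul_apply, ht.counit_eq_one, map_one]
  · rw [key, mul_antipode_dualHit_integral ht, dualHit_repr _ (ℛ k t), ← (ℛ k t).eq]
    simp [Finset.mul_sum]

end Integral

/-! ### The invariant functional h ↦ tr(x ↦ h S²(x)) -/

section TwistedTrace

theorem trace_eq_sum_coord {k M ι : Type*} [Field k] [AddCommGroup M] [Module k M] [Fintype ι]
    (b : Module.Basis ι k M) (f : M →ₗ[k] M) : trace k M f = ∑ i, b.coord i (f (b i)) := by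
  classical
  rw [trace_eq_matrix_trace k b, Matrix.trace]
  simp [toMatrix_apply]

theorem eq_sum_coord_smulRight {k M M' ι : Type*} [Field k] [AddCommGroup M] [Module k M]
    [AddCommGroup M'] [Module k M'] [Fintype ι] (b : Module.Basis ι k M) (f : M →ₗ[k] M') :
    f = ∑ i, (b.coord i).smulRight (f (b i)) := by
  ext x
  conv_lhs => rw [← b.sum_repr x, map_sum]
  simp

variable {k : Type u} {H : Type v} [Field k] [Ring H] [HopfAlgebra k H]

/-- The opposite convolution product: `h ↦ ∑ g(h₂) f(h₁)`. -/
noncomputable def convOp (f g : H →ₗ[k] H) : H →ₗ[k] H :=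
  (MulOpposite.opLinearEquiv k).symm.toLinearMap ∘ₗ
    conv ((MulOpposite.opLinearEquiv k).toLinearMap ∘ₗ f)
      ((MulOpposite.opLinearEquiv k).toLinearMap ∘ₗ g)

theorem convOp_repr (f g : H →ₗ[k] H) {h : H} {ι : Type*} (r : Coalgebra.Repr k h ι) :
    convOp f g h = ∑ i ∈ r.index, g (r.right i) * f (r.left i) := by
  simp [convOp, conv_repr _ _ r]

theorem op_comp_convOp (f g : H →ₗ[k] H) :
    (MulOpposite.opLinearEquiv k).toLinearMap ∘ₗ convOp f g =
    conv ((MulOpposite.opLinearEquiv k).toLinearMap ∘ₗ f)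
      ((MulOpposite.opLinearEquiv k).toLinearMap ∘ₗ g) := by
  ext; simp [convOp]

theorem convOp_assoc (f g l : H →ₗ[k] H) :
    convOp (convOp f g) l = convOp f (convOp g l) := by
  rw [convOp, op_comp_convOp, conv_assoc, convOp, op_comp_convOp]

theorem counit_convOp (f : H →ₗ[k] H) : convOp (scalarMap H counit) f = f := by
  have : (MulOpposite.opLinearEquiv k).toLinearMap ∘ₗ scalarMap H counit =
      scalarMap Hᵐᵒᵖ (counit : Module.Dual k H) := by ext; simp
  rw [convOp, this, counit_conv]
  ext; simp

/-- Applying the anti-multiplicative S to ∑ h₁ S(h₂) = ε(h) reverses the factors, hence the opposite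
convolution. -/
theorem convOp_antipode_sq :
    convOp (antipode k) (antipode k ∘ₗ antipode k) = scalarMap H (counit : Module.Dual k H) := by
  ext h
  have := congrArg (antipode k) (LinearMap.congr_fun (conv_id_antipode (k := k) (H := H)) h)
  rw [conv_repr _ _ (ℛ k h), map_sum] at this
  simp only [antipode_mul, id_apply, scalarMap_apply, Algebra.algebraMap_eq_smul_one, map_smul,
    antipode_one] at this
  rw [convOp_repr _ _ (ℛ k h), scalarMap_apply, Algebra.algebraMap_eq_smul_one, ← this]
  rfl

theorem convOp_smulRight (f : H →ₗ[k] H) (p : Module.Dual k H) (w : H) :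
    convOp f (p.smulRight w) = mulLeft k w ∘ₗ f ∘ₗ dualHit p := by
  ext h
  simp [convOp_repr _ _ (ℛ k h), dualHit_repr _ (ℛ k h)]

theorem comul_antipode_sq (h : H) : comul (R := k) (antipode k (antipode k h)) =
    TensorProduct.map (antipode k ∘ₗ antipode k) (antipode k ∘ₗ antipode k)
      (comul (R := k) h) := by
  rw [comul_antipode, comul_antipode, ← (ℛ k h).eq]
  simp

theorem sum_dualHit_coord_mul {ι : Type*} [Fintype ι] (b : Module.Basis ι k H) (w : H)
    (T : H →ₗ[k] H) : ∑ i, dualHit (b.coord i) w * T (b i) = conv LinearMap.id T w := by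
  conv_rhs => rw [eq_sum_coord_smulRight b T]
  simp only [conv, LinearMap.comp_apply]
  rw [← (ℛ k w).eq]
  simp only [dualHit_repr _ (ℛ k w), Finset.sum_mul, map_sum, TensorProduct.map_tmul, mul'_apply,
    LinearMap.sum_apply, Finset.mul_sum]
  rw [Finset.sum_comm]
  simp

/-- Expanding φ in the basis leaves terms (id * S * bⱼ^*)(φ(bⱼ)); id and S cancel, and the sum over
j is a trace. -/
theorem sum_convOp_antipode_dualHit {ι : Type*} [Fintype ι] (b : Module.Basis ι k H)
    (φ : H →ₗ[k] H) :
    ∑ i, convOp (antipode k) (dualHit (b.coord i) ∘ₗ φ) (b i) = algebraMap k H (trace k H φ) := by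
  have hφ : ∀ p : Module.Dual k H, ∀ x, convOp (antipode k) (dualHit p ∘ₗ φ) x =
      ∑ j, dualHit p (φ (b j)) * (antipode k ∘ₗ dualHit (b.coord j)) x := by
    intro p x
    have h : dualHit p ∘ₗ φ = ∑ j, (b.coord j).smulRight (dualHit p (φ (b j))) :=
      eq_sum_coord_smulRight b _
    have h' : ∀ w : ι → H, convOp (antipode k) (∑ j, (b.coord j).smulRight (w j)) x =
        ∑ j, convOp (antipode k) ((b.coord j).smulRight (w j)) x := by
      intro w
      simp only [convOp_repr _ _ (ℛ k x), LinearMap.sum_apply, Finset.sum_mul]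
      rw [Finset.sum_comm]
    rw [h, h']
    simp only [convOp_smulRight]
    rfl
  simp only [hφ]
  rw [Finset.sum_comm]
  simp only [sum_dualHit_coord_mul, ← conv_scalarMap, id_conv_antipode_conv]
  simp [trace_eq_sum_coord b]

variable (k H) in
/-- The functional `h ↦ tr (x ↦ h S²(x))`. -/
noncomputable def twistedTrace : Module.Dual k H :=
  trace k H ∘ₗ mulRight k (antipode k ∘ₗ antipode k : Module.End k H) ∘ₗ LinearMap.mul k H

theorem twistedTrace_apply (h : H) :
    twistedTrace k H h = trace k H (mulLeft k h ∘ₗ antipode k ∘ₗ antipode k) := rfl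

theorem dualHit_twistedTrace [Module.Finite k H] :
    dualHit (twistedTrace k H) = scalarMap H (twistedTrace k H) := by
  ext h
  let b := Module.finBasis k H
  let σ : H →ₗ[k] H := antipode k ∘ₗ antipode k
  let r := ℛ k h
  let W : Module.Dual k H → H →ₗ[k] H := fun p =>
    ∑ j ∈ r.index, (p ∘ₗ mulLeft k (r.right j) ∘ₗ σ).smulRight (r.left j)
  -- Since σ = S² is comultiplicative, p ⇀ (h σ(x)) = ∑ W p(x₂) σ(x₁); opposite convolution with S
  -- then removes σ without knowing S² = 1.
  have hW : ∀ p, dualHit p ∘ₗ mulLeft k h ∘ₗ σ = convOp σ (W p) := by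
    intro p
    ext x
    let rx := ℛ k x
    let rσ : Coalgebra.Repr k (σ x) (H × H) :=
      ⟨rx.index, fun i => σ (rx.left i), fun i => σ (rx.right i), by
        change _ = comul (R := k) (antipode k (antipode k x))
        rw [comul_antipode_sq, ← rx.eq]
        simp [σ]⟩
    have := dualHit_mul p h (σ x) rσ
    simp only [LinearMap.comp_apply, mulLeft_apply]
    rw [this, convOp_repr _ _ rx]
    refine Finset.sum_congr rfl fun i _ => ?_
    simp [dualHit_repr _ r, W, rσ]
  have hW' : ∀ p, W p = convOp (antipode k) (dualHit p ∘ₗ mulLeft k h ∘ₗ σ) := by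
    intro p
    rw [hW, ← convOp_assoc, convOp_antipode_sq, counit_convOp]
  have h₁ : dualHit (twistedTrace k H) h = ∑ i, W (b.coord i) (b i) := by
    simp only [dualHit_repr _ r, twistedTrace_apply, trace_eq_sum_coord b, W, LinearMap.sum_apply]
    rw [Finset.sum_comm]
    simp [Finset.sum_smul, σ]
  rw [h₁]
  simp only [hW']
  rw [sum_convOp_antipode_dualHit]
  rfl

/-- The endomorphism x ↦ t S²(x) = ε(x) t has rank one. -/
theorem twistedTrace_integral [Module.Finite k H] {t : H}
    (ht : IsIdempotentIntegral (⊤ : Subalgebra k H) t) : twistedTrace k H t = 1 := by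
  have : mulLeft k t ∘ₗ antipode k ∘ₗ antipode k = (counit : Module.Dual k H).smulRight t := by
    ext x
    simp [ht.right _ trivial]
  rw [twistedTrace_apply, this, trace_smulRight, ht.counit_eq_one]

end TwistedTrace

/-! ### Frobenius form, Nakayama automorphism and Radford's formula -/

section Frobenius

variable {k : Type u} {H : Type v} [Field k] [Ring H] [HopfAlgebra k H]

theorem dualHit_apply_of_counit (p : Module.Dual k H) (h : H) :
    counit (R := k) (dualHit p h) = p h := by
  rw [← dualMul_apply, dualMul_apply', dualHitRight_counit, id_apply]

theorem counit_dualHitRight (p : Module.Dual k H) (h : H) :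
    counit (R := k) (dualHitRight p h) = p h := by
  rw [← dualMul_apply', dualMul_apply, dualHit_counit, id_apply]

theorem comul_dualHitRight (p : Module.Dual k H) (h : H) :
    comul (R := k) (dualHitRight p h) = (dualHitRight p).rTensor H (comul (R := k) h) := by
  have h₁ := congrArg (TensorProduct.lid k (H ⊗[k] H) ∘ p.rTensor (H ⊗[k] H))
    (Coalgebra.coassoc_apply (R := k) h)
  have h₂ : ∀ z : H ⊗[k] H, TensorProduct.lid k (H ⊗[k] H) (p.rTensor (H ⊗[k] H)
      (TensorProduct.assoc k H H H ((comul (R := k)).rTensor H z))) =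
      (dualHitRight p).rTensor H z := by
    intro z
    induction z with
    | zero => simp
    | add x y hx hy => simp only [map_add, hx, hy]
    | tmul a b =>
      rw [rTensor_tmul, rTensor_tmul, dualHitRight_repr _ (ℛ k a), ← (ℛ k a).eq]
      simp [TensorProduct.sum_tmul, TensorProduct.smul_tmul']
  simp only [Function.comp_apply, h₂] at h₁
  rw [h₁, dualHitRight_repr _ (ℛ k h), ← (ℛ k h).eq]
  simp

variable {t : H} (ht : IsIdempotentIntegral (⊤ : Subalgebra k H) t)
include ht

variable [Module.Finite k H]

theorem dualHit_rightHit_integral (x : H) :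
    dualHit (rightHit (twistedTrace k H) x) t = antipode k x := by
  rw [← antipode_dualHit_leftHit dualHit_twistedTrace]
  have : leftHit t (twistedTrace k H) = counit := by
    ext y
    rw [leftHit_apply, ht.left _ trivial, map_smul, twistedTrace_integral ht, smul_eq_mul, mul_one]
  rw [this, dualHit_counit, id_apply]

theorem antipode_dualHit_leftHit_integral (y : H) :
    antipode k (dualHit (leftHit y (twistedTrace k H)) t) = y := by
  rw [antipode_dualHit_leftHit dualHit_twistedTrace]
  have : rightHit (twistedTrace k H) t = counit := by
    ext y
    rw [rightHit_apply, ht.right _ trivial, map_smul, twistedTrace_integral ht, smul_eq_mul,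
      mul_one]
  rw [this, dualHit_counit, id_apply]

theorem antipode_injective : Function.Injective (antipode k (A := H)) :=
  LinearMap.injective_iff_surjective.mpr fun y => ⟨_, antipode_dualHit_leftHit_integral ht y⟩

theorem antipode_surjective : Function.Surjective (antipode k (A := H)) :=
  fun y => ⟨_, antipode_dualHit_leftHit_integral ht y⟩

theorem exists_eq_leftHit_twistedTrace (p : Module.Dual k H) :
    ∃ y, p = leftHit y (twistedTrace k H) := by
  let F : H →ₗ[k] Module.Dual k H := (LinearMap.mul k H).flip.compr₂ (twistedTrace k H)
  have hF : ∀ y, F y = leftHit y (twistedTrace k H) := fun y => by ext; simp [F]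
  have hinj : Function.Injective F := by
    intro y z h
    rw [hF, hF] at h
    rw [← antipode_dualHit_leftHit_integral ht y, h, antipode_dualHit_leftHit_integral ht z]
  obtain ⟨y, hy⟩ := (LinearMap.injective_iff_surjective_of_finrank_eq_finrank
    (Subspace.dual_finrank_eq (K := k) (V := H)).symm).mp hinj p
  exact ⟨y, by rw [← hy, hF]⟩

theorem eq_of_dualHit_integral_eq {p q : Module.Dual k H} (h : dualHit p t = dualHit q t) :
    p = q := by
  obtain ⟨y, rfl⟩ := exists_eq_leftHit_twistedTrace ht p
  obtain ⟨z, rfl⟩ := exists_eq_leftHit_twistedTrace ht q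
  have := congrArg (antipode k) h
  rw [antipode_dualHit_leftHit_integral ht, antipode_dualHit_leftHit_integral ht] at this
  rw [this]

/-- A functional is determined by its hit on t, and S sends the hits of λ(x ·) and λ(· S²(x)) on t
to the same element S²(x). So S² is the Nakayama automorphism of λ. -/
theorem twistedTrace_mul (x y : H) :
    twistedTrace k H (x * y) = twistedTrace k H (y * antipode k (antipode k x)) := by
  have : rightHit (twistedTrace k H) x =
      leftHit (antipode k (antipode k x)) (twistedTrace k H) := by
    apply eq_of_dualHit_integral_eq ht
    apply antipode_injective ht
    rw [antipode_dualHit_leftHit_integral ht, dualHit_rightHit_integral ht]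
  exact LinearMap.congr_fun this y

theorem eq_smul_twistedTrace {p : Module.Dual k H} (hp : dualHit p = scalarMap H p) :
    p = p t • twistedTrace k H := by
  apply eq_of_dualHit_integral_eq ht
  have : dualHit (p t • twistedTrace k H) t = p t • dualHit (twistedTrace k H) t := by
    simp [dualHit_repr _ (ℛ k t), Finset.smul_sum, smul_smul]
  rw [this, hp, dualHit_twistedTrace, scalarMap_apply, scalarMap_apply, twistedTrace_integral ht,
    map_one, Algebra.algebraMap_eq_smul_one]

theorem antipode_integral : antipode k t = t := by
  obtain ⟨s, hs⟩ := antipode_surjective ht t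
  have h₁ := ht.right (antipode k t) trivial
  rw [counit_antipode, ht.counit_eq_one, one_smul] at h₁
  have h₂ : t * antipode k t = antipode k t := by
    have h₃ : counit (R := k) s = 1 := by
      rw [← counit_antipode (R := k) s, hs, ht.counit_eq_one]
    have h₄ := congrArg (antipode k) (ht.right s trivial)
    rwa [antipode_mul, hs, map_smul, h₃, one_smul] at h₄
  rw [← h₂, h₁]

/-- The distinguished group-like element: `∑ λ(h₁) h₂ = λ(h) g`. -/
theorem dualHitRight_twistedTrace (h : H) : dualHitRight (twistedTrace k H) h =
    twistedTrace k H h • dualHitRight (twistedTrace k H) t := by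
  rw [← sub_eq_zero, ← Module.forall_dual_apply_eq_zero_iff k]
  intro p
  -- λp inherits the invariance of λ, so it is a multiple of λ; its value at t identifies the factor
  -- as p(g).
  have hl : dualHit (dualMul (twistedTrace k H) p) =
      scalarMap H (dualMul (twistedTrace k H) p) := by
    rw [← dualHit_comp_dualHit, dualHit_twistedTrace]
    ext
    simp [dualMul_apply]
  have := LinearMap.congr_fun (eq_smul_twistedTrace ht hl) h
  simp only [dualMul_apply', LinearMap.smul_apply, smul_eq_mul] at this
  rw [map_sub, map_smul, this, smul_eq_mul, mul_comm, sub_self]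

theorem isGroupLikeElem_dualHitRight_integral :
    IsGroupLikeElem k (dualHitRight (twistedTrace k H) t) := by
  refine ⟨by rw [counit_dualHitRight, twistedTrace_integral ht], ?_⟩
  set g := dualHitRight (twistedTrace k H) t with hg
  have h₁ := comul_dualHitRight (twistedTrace k H) t
  have h₂ : ∀ x, dualHitRight (twistedTrace k H) x = twistedTrace k H x • g :=
    dualHitRight_twistedTrace ht
  rw [← hg, ← (ℛ k t).eq, map_sum] at h₁
  simp only [rTensor_tmul, h₂, TensorProduct.smul_tmul] at h₁
  rw [h₁, ← TensorProduct.tmul_sum, ← dualHitRight_repr]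

/-- Cancelling g in ∑ λ(x₁ g) x₂ g = λ(x g) g shows that λ(· g) is invariant on the other side.
Composition with S switches sides back, so uniqueness gives a multiple of λ, normalised by S(t) = t
and t g = t. -/
theorem twistedTrace_antipode_mul (h : H) :
    twistedTrace k H (antipode k h * dualHitRight (twistedTrace k H) t) = twistedTrace k H h := by
  have hg := isGroupLikeElem_dualHitRight_integral ht
  have hR := dualHitRight_twistedTrace ht
  set g := dualHitRight (twistedTrace k H) t
  have hν : dualHitRight (leftHit g (twistedTrace k H)) =
      scalarMap H (leftHit g (twistedTrace k H)) := by
    ext x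
    have h₁ := hR (x * g)
    have h₂ : dualHitRight (twistedTrace k H) (x * g) =
        dualHitRight (leftHit g (twistedTrace k H)) x * g := by
      rw [dualHitRight_repr _ (ℛ k x), dualHitRight]
      simp only [LinearMap.comp_apply, Bialgebra.comul_mul, hg.comul_eq_tmul_self]
      rw [← (ℛ k x).eq]
      simp [Finset.sum_mul]
    rw [h₂] at h₁
    have h₃ := congrArg (· * antipode k g) h₁
    simp only [mul_assoc, smul_mul_assoc, hg.mul_antipode_cancel, mul_one] at h₃
    rw [h₃, scalarMap_apply, Algebra.algebraMap_eq_smul_one, leftHit_apply]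
  have hl : dualHit (leftHit g (twistedTrace k H) ∘ₗ antipode k) =
      scalarMap H (leftHit g (twistedTrace k H) ∘ₗ antipode k) := by
    ext x
    apply antipode_injective ht
    rw [← dualHitRight_antipode, hν]
    simp [Algebra.algebraMap_eq_smul_one, antipode_one]
  have h₁ := LinearMap.congr_fun (eq_smul_twistedTrace ht hl) h
  simp only [LinearMap.comp_apply, leftHit_apply, antipode_integral ht,
    ht.right g trivial, hg.counit_eq_one, one_smul, twistedTrace_integral ht] at h₁
  exact h₁

/-- Radford's formula for the fourth power of the antipode, in the unimodular case. -/
theorem mul_antipode_pow_four (y : H) : dualHitRight (twistedTrace k H) t *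
      antipode k (antipode k (antipode k (antipode k y))) =
    y * dualHitRight (twistedTrace k H) t := by
  have hg := isGroupLikeElem_dualHitRight_integral ht
  have hS := twistedTrace_antipode_mul ht
  set g := dualHitRight (twistedTrace k H) t
  obtain ⟨y, rfl⟩ := antipode_surjective ht y
  -- z is chosen with S(z) g = g S³(y). Then λ(xy) = λ(S(y) S(x) g) = λ(S(x) g S³(y)) = λ(zx) = λ(x
  -- S²(z)), so y = S²(z) by nondegeneracy.
  obtain ⟨z, hz⟩ := antipode_surjective ht (g * antipode k (antipode k (antipode k y)) *
    antipode k g)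
  have hz' : antipode k z * g = g * antipode k (antipode k (antipode k y)) := by
    rw [hz, mul_assoc, hg.antipode_mul_cancel, mul_one]
  have h₁ : ∀ x, twistedTrace k H (x * y) = twistedTrace k H (x * antipode k (antipode k z)) := by
    intro x
    rw [← hS, antipode_mul, mul_assoc, twistedTrace_mul ht, mul_assoc, ← hz', ← mul_assoc,
      ← antipode_mul, hS, twistedTrace_mul ht]
  have h₂ : y = antipode k (antipode k z) := by
    rw [← antipode_dualHit_leftHit_integral ht y]
    have : leftHit y (twistedTrace k H) =
        leftHit (antipode k (antipode k z)) (twistedTrace k H) := by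
      ext x; exact h₁ x
    rw [this, antipode_dualHit_leftHit_integral ht]
  have h₃ := congrArg (fun x => antipode k (antipode k x)) hz'
  simp only [antipode_mul, hg.antipode_antipode] at h₃
  rw [← h₃, h₂]

/-- Group-like elements are linearly independent, so in finite dimension they form a finite group.
-/
theorem exists_pow_dualHitRight_integral_eq_one :
    ∃ m : ℕ, 0 < m ∧ dualHitRight (twistedTrace k H) t ^ m = 1 := by
  let g : GroupLike k H := ⟨_, isGroupLikeElem_dualHitRight_integral ht⟩
  have : Finite (GroupLike k H) := (linearIndep_groupLikeVal (R := k) (A := H)).finite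
  obtain ⟨m, hm, hg⟩ := isOfFinOrder_iff_pow_eq_one.mp (isOfFinOrder_of_finite g)
  exact ⟨m, hm, by simpa [g] using congrArg GroupLike.val hg⟩

end Frobenius

/-! ### Nonvanishing of the trace of an inner automorphism -/

section TraceOfConjugation

theorem exists_trace_eq_natCast_of_isIdempotentElem {K V : Type*} [Field K] [AddCommGroup V]
    [Module K V] [Module.Finite K V] {f : Module.End K V} (hf : IsIdempotentElem f) :
    ∃ m : ℕ, m ≤ Module.finrank K V ∧ trace K V f = m :=
  ⟨_, Submodule.finrank_le _, hf.isProj_range.trace⟩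

/-- The traces of the powers of a matrix of finite order, in terms of eigenvalue multiplicities. -/
theorem exists_trace_pow_eq_sum {K n : Type*} [Field K] [CharZero K] [Fintype n] [DecidableEq n]
    {M : ℕ} (hM : 0 < M) {ζ : K} (hζ : IsPrimitiveRoot ζ M) {U : Matrix n n K} (hU : U ^ M = 1) :
    ∃ m : ℕ → ℕ, ∀ e : ℕ, (U ^ e).trace = ∑ i ∈ Finset.range M, (ζ ^ i) ^ e * m i := by
  have hM0 : (M : K) ≠ 0 := by exact_mod_cast hM.ne'
  have hζ0 : ζ ≠ 0 := hζ.ne_zero hM.ne'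
  let a : ℕ → Matrix n n K := fun i => ((ζ ^ i)⁻¹) • U
  -- The projector onto the ζ^i-eigenspace of U; its trace is its rank, the multiplicity m i.
  let P : ℕ → Matrix n n K := fun i => (M : K)⁻¹ • ∑ j ∈ Finset.range M, a i ^ j
  have haM : ∀ i, a i ^ M = 1 := fun i => by
    rw [smul_pow, hU, inv_pow, ← pow_mul, mul_comm i, pow_mul, hζ.pow_eq_one, one_pow, inv_one,
      one_smul]
  have haP : ∀ i, a i * P i = P i := fun i => by
    have := mul_geom_sum (a i) M
    rw [haM, sub_self, sub_mul, one_mul, sub_eq_zero] at this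
    rw [mul_smul_comm, this]
  have haP' : ∀ i j, a i ^ j * P i = P i := fun i j => by
    induction j with
    | zero => rw [pow_zero, one_mul]
    | succ j ih => rw [pow_succ, mul_assoc, haP, ih]
  have hPP : ∀ i, IsIdempotentElem (P i) := fun i => by
    change ((M : K)⁻¹ • ∑ j ∈ Finset.range M, a i ^ j) * P i = P i
    rw [smul_mul_assoc, Finset.sum_mul]
    simp only [haP', Finset.sum_const, Finset.card_range]
    rw [← Nat.cast_smul_eq_nsmul K, smul_smul, inv_mul_cancel₀ hM0, one_smul]
  have hUP : ∀ i e, U ^ e * P i = (ζ ^ i) ^ e • P i := fun i e => by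
    have : U = ζ ^ i • a i := by
      rw [smul_smul, mul_inv_cancel₀ (pow_ne_zero _ hζ0), one_smul]
    conv_lhs => rw [this]
    rw [smul_pow, smul_mul_assoc, haP']
  have hsum : ∑ i ∈ Finset.range M, P i = 1 := by
    simp only [P, ← Finset.smul_sum]
    rw [Finset.sum_comm]
    have h : ∀ j ∈ Finset.range M, j ≠ 0 → ∑ i ∈ Finset.range M, a i ^ j = 0 := by
      intro j hj hj0
      have h₁ : ∀ i, a i ^ j = ((ζ ^ j)⁻¹) ^ i • U ^ j := fun i => by
        rw [smul_pow, inv_pow, inv_pow, ← pow_mul, ← pow_mul, mul_comm]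
      have h₂ : (ζ ^ j)⁻¹ ≠ 1 := by
        rw [ne_eq, inv_eq_one]
        exact hζ.pow_ne_one_of_pos_of_lt hj0 (Finset.mem_range.mp hj)
      have h₃ := mul_geom_sum ((ζ ^ j)⁻¹) M
      rw [inv_pow, ← pow_mul, mul_comm j, pow_mul, hζ.pow_eq_one, one_pow, inv_one, sub_self] at h₃
      simp only [h₁, ← Finset.sum_smul]
      rw [(mul_eq_zero.mp h₃).resolve_left (sub_ne_zero.mpr h₂), zero_smul]
    rw [Finset.sum_eq_single_of_mem 0 (Finset.mem_range.mpr hM) h]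
    simp only [pow_zero, Finset.sum_const, Finset.card_range]
    rw [← Nat.cast_smul_eq_nsmul K, smul_smul, inv_mul_cancel₀ hM0, one_smul]
  have hm : ∀ i, ∃ m : ℕ, (P i).trace = m := fun i => by
    have h := (hPP i).map (Matrix.toLinAlgEquiv' (R := K) (n := n))
    obtain ⟨m, -, hm⟩ := exists_trace_eq_natCast_of_isIdempotentElem h
    exact ⟨m, by rw [← hm]; exact (Matrix.trace_toLin'_eq (P i)).symm⟩
  choose m hm using hm
  refine ⟨m, fun e => ?_⟩
  rw [← mul_one (U ^ e), ← hsum, Finset.mul_sum, Matrix.trace_sum]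
  simp only [hUP, Matrix.trace_smul, hm, smul_eq_mul]

/-- After dividing U by an M-th root of c, its eigenvalues are roots of unity. In ℂ their inverses
are their conjugates, so the product of traces is a squared modulus; the rescaling cancels. -/
theorem exists_map_trace_mul_trace_eq {K : Type*} [Field K] [CharZero K] [IsAlgClosed K]
    [Algebra ℚ K] (φ : algebraicClosure ℚ K →+* ℂ) {n : Type*} [Fintype n] [DecidableEq n]
    {M : ℕ} (hM : 0 < M) {U V : Matrix n n K} (hUV : U * V = 1) {c : K} (hc : U ^ M = c • 1) :
    ∃ x : algebraicClosure ℚ K, (x : K) = U.trace * V.trace ∧ ∃ r : ℝ, 0 ≤ r ∧ φ x = r := by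
  cases isEmpty_or_nonempty n
  · exact ⟨0, by simp [Matrix.trace], 0, le_rfl, by simp⟩
  have hM' : NeZero (M : K) := ⟨by exact_mod_cast hM.ne'⟩
  obtain ⟨ζ, hζ⟩ := HasEnoughRootsOfUnity.exists_primitiveRoot K M
  have hc0 : c ≠ 0 := by
    rintro rfl
    have h : IsUnit (U ^ M) := (IsUnit.of_mul_eq_one V hUV).pow M
    rw [hc, zero_smul] at h
    exact not_isUnit_zero h
  obtain ⟨r, hr⟩ := IsAlgClosed.exists_pow_nat_eq c hM
  have hr0 : r ≠ 0 := by
    rintro rfl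
    rw [zero_pow hM.ne'] at hr
    exact hc0 hr.symm
  have hU' : (r⁻¹ • U) ^ M = 1 := by
    rw [smul_pow, hc, smul_smul, inv_pow, hr, inv_mul_cancel₀ hc0, one_smul]
  have hV' : (r⁻¹ • U) ^ (M - 1) = r • V := by
    have h : (r⁻¹ • U) * (r • V) = 1 := by
      rw [smul_mul_smul_comm, inv_mul_cancel₀ hr0, one_smul, hUV]
    calc (r⁻¹ • U) ^ (M - 1) = (r⁻¹ • U) ^ (M - 1) * ((r⁻¹ • U) * (r • V)) := by rw [h, mul_one]
      _ = r • V := by rw [← mul_assoc, ← pow_succ, Nat.sub_add_cancel hM, hU', one_mul]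
  obtain ⟨m, hm⟩ := exists_trace_pow_eq_sum hM hζ hU'
  have h₁ := hm 1
  have h₂ := hm (M - 1)
  rw [pow_one, Matrix.trace_smul, smul_eq_mul] at h₁
  rw [hV', Matrix.trace_smul, smul_eq_mul] at h₂
  have hζalg : ζ ∈ algebraicClosure ℚ K := by
    rw [mem_algebraicClosure_iff]
    exact ((hζ.isIntegral hM).tower_top (A := ℚ)).isAlgebraic
  let z : algebraicClosure ℚ K := ⟨ζ, hζalg⟩
  have hz : z ^ M = 1 := Subtype.ext hζ.pow_eq_one
  have hφ : ‖φ z‖ = 1 := by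
    refine (pow_eq_one_iff_of_nonneg (norm_nonneg _) hM.ne').mp ?_
    rw [← norm_pow, ← map_pow, hz, map_one, norm_one]
  have hconj : ∀ i, φ ((z ^ i) ^ (M - 1)) = starRingEnd ℂ (φ (z ^ i)) := by
    intro i
    have hφi : ‖φ (z ^ i)‖ = 1 := by rw [map_pow, norm_pow, hφ, one_pow]
    have h : φ (z ^ i) * φ ((z ^ i) ^ (M - 1)) = 1 := by
      rw [← map_mul, ← pow_succ', Nat.sub_add_cancel hM, ← pow_mul, mul_comm, pow_mul, hz, one_pow,
        map_one]
    rw [← Complex.inv_eq_conj hφi]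
    exact (inv_eq_of_mul_eq_one_right h).symm
  let y : algebraicClosure ℚ K := ∑ i ∈ Finset.range M, (z ^ i) ^ 1 * m i
  let y' : algebraicClosure ℚ K := ∑ i ∈ Finset.range M, (z ^ i) ^ (M - 1) * m i
  refine ⟨y * y', ?_, Complex.normSq (φ y), Complex.normSq_nonneg _, ?_⟩
  · have hy : (y : K) = r⁻¹ * U.trace := by rw [h₁]; simp [y, z]
    have hy' : (y' : K) = r * V.trace := by rw [h₂]; simp [y', z]
    rw [MulMemClass.coe_mul, hy, hy']
    field_simp
  · have : φ y' = starRingEnd ℂ (φ y) := by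
      simp only [y, y', map_sum, map_mul, map_natCast, hconj, pow_one]
    rw [map_mul, this, Complex.mul_conj]

theorem trace_mulLeft_comp_mulRight_pi {K : Type*} [Field K] {n : ℕ} (d : Fin n → ℕ)
    (a b : Π i, Matrix (Fin (d i)) (Fin (d i)) K) :
    trace K _ (mulLeft K a ∘ₗ mulRight K b) = ∑ i, (a i).trace * (b i).trace := by
  classical
  let B := Pi.basis fun i => Matrix.stdBasis K (Fin (d i)) (Fin (d i))
  rw [trace_eq_sum_coord B, Fintype.sum_sigma]
  refine Finset.sum_congr rfl fun i _ => ?_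
  rw [Fintype.sum_prod_type, Matrix.trace, Matrix.trace, Finset.sum_mul_sum]
  refine Finset.sum_congr rfl fun r _ => Finset.sum_congr rfl fun s _ => ?_
  have h : (a * (B ⟨i, (r, s)⟩ * b)) i = a i * (Matrix.single r s 1 * b i) := by
    simp [B, Matrix.stdBasis_eq_single]
  rw [Module.Basis.coord_apply, LinearMap.comp_apply, mulLeft_apply, mulRight_apply, Pi.basis_repr,
    h]
  change (a i * (Matrix.single r s 1 * b i) : Matrix (Fin (d i)) (Fin (d i)) K) r s = _
  rw [← mul_assoc, Matrix.mul_apply, Finset.sum_eq_single s]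
  · simp
  · intro j _ hj
    simp [Matrix.mul_single_apply_of_ne, hj]
  · simp

theorem exists_smul_one_of_commute_baseChange {k K A : Type*} [Field k] [Field K] [Algebra k K]
    [Ring A] [Algebra k A] {n : ℕ} {d : Fin n → ℕ}
    (e : K ⊗[k] A ≃ₐ[K] Π i, Matrix (Fin (d i)) (Fin (d i)) K) {z : A}
    (hz : ∀ x, z * x = x * z) (i : Fin n) : ∃ c : K, e (1 ⊗ₜ z) i = c • 1 := by
  have h₁ : ∀ y, (1 ⊗ₜ z) * y = y * (1 ⊗ₜ[k] z : K ⊗[k] A) := by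
    intro y
    induction y with
    | zero => simp
    | add x y hx hy => rw [mul_add, add_mul, hx, hy]
    | tmul c x => simp [hz]
  have h₂ : ∀ X : Matrix (Fin (d i)) (Fin (d i)) K, e (1 ⊗ₜ z) i * X = X * e (1 ⊗ₜ z) i := by
    intro X
    have h := congrArg (fun y => e y i) (h₁ (e.symm (Pi.single i X)))
    simpa using h
  obtain ⟨c, hc⟩ := Matrix.mem_range_scalar_of_commute_single
    (M := e (1 ⊗ₜ z) i) fun r s _ => (h₂ _).symm
  exact ⟨c, by rw [← hc, Matrix.smul_one_eq_diagonal]; rfl⟩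

/-- Over K the algebra is a product of matrix algebras and the trace is ∑ tr(αᵢ) tr(βᵢ), each term
nonnegative after embedding algebraic numbers in ℂ. On a block where the central t is nonzero, `hc`
makes αᵢ scalar, so that term is positive. -/
theorem trace_conj_ne_zero_of_isAlgClosed {k A : Type*} (K : Type*) [Field k] [Field K]
    [CharZero K] [IsAlgClosed K] [Algebra k K] [Ring A] [Algebra k A]
    {s : A ⊗[k] A} (hs : IsSeparabilityIdempotent k s) {a b : A} (hab : a * b = 1) {M : ℕ}
    (hM : 0 < M) (ha : ∀ x, a ^ M * x = x * a ^ M) {t : A} (ht0 : t ≠ 0)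
    (ht : ∀ x, t * x = x * t) {c : k} (hc : a * t = c • t) :
    trace k A (mulLeft k a ∘ₗ mulRight k b) ≠ 0 := by
  have := hs.finite
  obtain ⟨s', hs'⟩ := hs.baseChange K
  have := hs'.isSemisimpleRing
  obtain ⟨n, d, hd, ⟨e⟩⟩ :=
    IsSemisimpleRing.exists_algEquiv_pi_matrix_of_isAlgClosed K (K ⊗[k] A)
  let α := e (1 ⊗ₜ a)
  let β := e (1 ⊗ₜ b)
  let τ := e (1 ⊗ₜ t)
  have hαβ : ∀ i, α i * β i = 1 := fun i => by
    rw [← Pi.mul_apply, ← map_mul, Algebra.TensorProduct.tmul_mul_tmul, hab, one_mul,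
      ← Algebra.TensorProduct.one_def, map_one, Pi.one_apply]
  have hατ : ∀ i, α i * τ i = algebraMap k K c • τ i := fun i => by
    rw [← Pi.mul_apply, ← map_mul, Algebra.TensorProduct.tmul_mul_tmul, hc, one_mul,
      TensorProduct.tmul_smul, ← algebraMap_smul K, map_smul, Pi.smul_apply]
  have hαM : ∀ i, ∃ r : K, α i ^ M = r • 1 := fun i => by
    obtain ⟨r, hr⟩ := exists_smul_one_of_commute_baseChange e ha i
    refine ⟨r, ?_⟩
    rw [← hr, ← Pi.pow_apply, ← map_pow, Algebra.TensorProduct.tmul_pow, one_pow]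
  have htr : algebraMap k K (trace k A (mulLeft k a ∘ₗ mulRight k b)) =
      ∑ i, (α i).trace * (β i).trace := by
    rw [← trace_baseChange, ← trace_mulLeft_comp_mulRight_pi,
      ← trace_conj' _ e.toLinearEquiv]
    congr 1
    apply LinearMap.ext
    intro y
    obtain ⟨y, rfl⟩ := e.surjective y
    have h : ((mulLeft k a ∘ₗ mulRight k b).baseChange K) y = (1 ⊗ₜ a) * (y * (1 ⊗ₜ b)) := by
      induction y with
      | zero => simp
      | add x y hx hy => rw [map_add, hx, hy, add_mul, mul_add]
      | tmul c x => simp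
    simp [LinearEquiv.conj_apply, h, α, β]
  have : Algebra.IsAlgebraic ℚ (algebraicClosure ℚ K) := by
    convert algebraicClosure.isAlgebraic ℚ K
    · rfl
    · exact Subsingleton.elim _ _
  let φ : algebraicClosure ℚ K →ₐ[ℚ] ℂ := IsAlgClosed.lift
  choose x hx r hr hφ using fun i =>
    (hαM i).elim fun _ h => exists_map_trace_mul_trace_eq φ.toRingHom hM (hαβ i) h
  obtain ⟨i, hi⟩ : ∃ i, τ i ≠ 0 := by
    by_contra! h
    have h₁ : e (1 ⊗ₜ t) = 0 := funext h
    rw [map_eq_zero_iff _ e.injective] at h₁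
    refine ht0 (Algebra.TensorProduct.includeRight_injective (R := k) (A := K) (B := A)
      (algebraMap k K).injective ?_)
    simpa using h₁
  obtain ⟨q, hq⟩ := exists_smul_one_of_commute_baseChange e ht i
  have hq0 : q ≠ 0 := by
    rintro rfl
    exact hi (by rw [← zero_smul K (1 : Matrix (Fin (d i)) (Fin (d i)) K), ← hq])
  have hα : α i = algebraMap k K c • 1 := by
    have h := hατ i
    change α i * e (1 ⊗ₜ t) i = _ • e (1 ⊗ₜ t) i at h
    rw [hq, smul_comm, mul_smul_comm, mul_one] at h
    exact smul_right_injective _ hq0 h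
  have hri : 0 < r i := by
    refine (hr i).lt_of_ne' fun h0 => ?_
    have h₁ := hφ i
    rw [h0, Complex.ofReal_zero] at h₁
    have h₂ : x i = 0 := (map_eq_zero_iff _ φ.toRingHom.injective).mp h₁
    have h₃ := hx i
    have h₄ := congrArg Matrix.trace (hαβ i)
    rw [h₂, ZeroMemClass.coe_zero, hα, Matrix.trace_smul] at h₃
    rw [hα, smul_mul_assoc, one_mul, Matrix.trace_smul] at h₄
    have h₅ : ((d i : ℕ) : K) ≠ 0 := by
      exact_mod_cast (hd i).out
    rw [Matrix.trace_one, Fintype.card_fin] at h₃ h₄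
    apply h₅
    have h₆ : ((d i : ℕ) : K) * (algebraMap k K c • (β i).trace) = 0 := by
      rw [h₃, smul_eq_mul, smul_eq_mul]; ring
    rw [h₄] at h₆
    exact mul_self_eq_zero.mp h₆
  intro h0
  rw [h0, map_zero] at htr
  have h₁ : ∑ i, x i = 0 := by
    apply Subtype.ext
    rw [ZeroMemClass.coe_zero, htr, AddSubmonoidClass.coe_finsetSum]
    exact Finset.sum_congr rfl fun i _ => hx i
  have h₂ := congrArg φ.toRingHom h₁
  rw [map_sum, map_zero] at h₂
  simp only [hφ] at h₂
  have h₃ : ∑ i, r i = 0 := by exact_mod_cast h₂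
  exact (Finset.sum_pos' (fun i _ => hr i) ⟨i, Finset.mem_univ _, hri⟩).ne' h₃

/-- An inner automorphism of finite order of a separable algebra in characteristic zero has nonzero
trace, provided that the conjugating element acts as a scalar on some central element. -/
theorem trace_conj_ne_zero {k A : Type*} [Field k] [CharZero k] [Ring A] [Algebra k A]
    {s : A ⊗[k] A} (hs : IsSeparabilityIdempotent k s) {a b : A} (hab : a * b = 1) {M : ℕ}
    (hM : 0 < M) (ha : ∀ x, a ^ M * x = x * a ^ M) {t : A} (ht0 : t ≠ 0)
    (ht : ∀ x, t * x = x * t) {c : k} (hc : a * t = c • t) :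
    trace k A (mulLeft k a ∘ₗ mulRight k b) ≠ 0 := by
  have : CharZero (AlgebraicClosure k) :=
    charZero_of_injective_algebraMap (algebraMap k (AlgebraicClosure k)).injective
  exact trace_conj_ne_zero_of_isAlgClosed (AlgebraicClosure k) hs hab hM ha ht0 ht hc

end TraceOfConjugation

/-! ### The regular character -/

section RegularCharacter

theorem character_apply {k A V : Type*} [Field k] [Ring A] [Algebra k A] [AddCommGroup V]
    [Module k V] [Module A V] [IsScalarTower k A V] (a : A) :
    character k A V a = trace k V (Algebra.lsmul k k V a) := rfl

theorem character_self_apply {k A : Type*} [Field k] [Ring A] [Algebra k A] (a : A) :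
    character k A A a = trace k A (mulLeft k a) := by
  rw [character_apply]
  congr 1

theorem character_self_mul_comm {k A : Type*} [Field k] [Ring A] [Algebra k A] (a b : A) :
    character k A A (a * b) = character k A A (b * a) := by
  rw [character_self_apply, character_self_apply, mulLeft_mul, mulLeft_mul]
  exact trace_mul_comm k (mulLeft k a : Module.End k A) (mulLeft k b)

theorem eq_zero_of_character_self_idempotent {k A : Type*} [Field k] [CharZero k] [Ring A]
    [Algebra k A] [Module.Finite k A] {e : A} (he : e * e = e) (h0 : character k A A e = 0) :
    e = 0 := by
  have h₁ : IsIdempotentElem (mulLeft k e) := by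
    rw [IsIdempotentElem, Module.End.mul_eq_comp, ← mulLeft_mul, he]
  rw [character_self_apply, IsIdempotentElem.trace_eq_zero_iff h₁] at h0
  simpa using LinearMap.congr_fun h0 1

/-- The radical of the trace form is a left ideal, hence generated by an idempotent; that idempotent
has trace 0, so rank 0 in characteristic 0. -/
theorem eq_zero_of_forall_character_self_eq_zero {k A : Type*} [Field k] [CharZero k] [Ring A]
    [Algebra k A] [Module.Finite k A] [IsSemisimpleRing A] {x : A}
    (hx : ∀ a, character k A A (a * x) = 0) : x = 0 := by
  let X : Submodule A A :=
    { carrier := {x | ∀ a, character k A A (a * x) = 0}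
      add_mem' := fun {x y} hx hy a => by rw [mul_add, map_add, hx, hy, add_zero]
      zero_mem' := fun a => by rw [mul_zero, map_zero]
      smul_mem' := fun b x hx a => by rw [smul_eq_mul, ← mul_assoc, hx] }
  obtain ⟨Y, hXY⟩ := exists_isCompl X
  have h1 : (1 : A) ∈ X ⊔ Y := by rw [hXY.sup_eq_top]; trivial
  obtain ⟨e, he, f, hf, hef⟩ := Submodule.mem_sup.mp h1
  have key : ∀ y ∈ X, y * e = y := by
    intro y hy
    have h₁ : y * f = y - y * e := by rw [eq_sub_iff_add_eq', ← mul_add, hef, mul_one]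
    have h₂ : y * f ∈ X := by rw [h₁]; exact X.sub_mem hy (X.smul_mem y he)
    have h₃ := (Submodule.disjoint_def.mp hXY.disjoint) _ h₂ (Y.smul_mem y hf)
    rw [h₁, sub_eq_zero] at h₃
    exact h₃.symm
  have he0 : e = 0 := eq_zero_of_character_self_idempotent (k := k) (key e he)
    (by simpa using he 1)
  rw [← key x hx, he0, mul_zero]

variable {k : Type u} {H : Type v} [Field k] [Ring H] [HopfAlgebra k H]

/-- The bijection Θ(a ⊗ b) = Δ(a)(1 ⊗ b) intertwines the action of H on the left factor alone with
the diagonal action on H ⊗ H. -/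
theorem dualMul_character_self [Module.Finite k H] :
    dualMul (character k H H) (character k H H) =
      (Module.finrank k H : k) • character k H H := by
  let i₁ : H →ₐ[k] H ⊗[k] H := Algebra.TensorProduct.includeLeft
  let i₂ : H →ₐ[k] H ⊗[k] H := Algebra.TensorProduct.includeRight
  let D : H →ₐ[k] H ⊗[k] H := Bialgebra.comulAlgHom k H
  let Θ : H ⊗[k] H →ₗ[k] H ⊗[k] H := mul' k (H ⊗[k] H) ∘ₗ TensorProduct.map D.toLinearMap
    i₂.toLinearMap
  have hΘ : ∀ a b, Θ (a ⊗ₜ b) = D a * (1 ⊗ₜ b) := fun a b => by simp [Θ, i₂]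
  have hsurj : Function.Surjective Θ := by
    rw [← range_eq_top, eq_top_iff, ← TensorProduct.span_tmul_eq_top, Submodule.span_le]
    rintro _ ⟨a, b, rfl⟩
    have h₁ : conv D.toLinearMap (i₂.toLinearMap ∘ₗ antipode k) = i₁.toLinearMap := by
      rw [show D.toLinearMap = conv i₁.toLinearMap i₂.toLinearMap from comulAlgHom_eq_conv,
        conv_assoc, algHom_conv_antipode, conv_counit]
    have h₂ := LinearMap.congr_fun h₁ a
    rw [conv_repr _ _ (ℛ k a)] at h₂
    refine ⟨∑ i ∈ (ℛ k a).index, (ℛ k a).left i ⊗ₜ (antipode k ((ℛ k a).right i) * b), ?_⟩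
    have h₃ := congrArg (· * ((1 : H) ⊗ₜ[k] b)) h₂
    simp only [Finset.sum_mul, mul_assoc] at h₃
    simpa [hΘ, i₁, i₂] using h₃
  let e : H ⊗[k] H ≃ₗ[k] H ⊗[k] H :=
    LinearEquiv.ofBijective Θ ⟨LinearMap.injective_iff_surjective.mpr hsurj, hsurj⟩
  ext h
  have h₁ : dualMul (character k H H) (character k H H) h =
      trace k (H ⊗[k] H) (mulLeft k (D h)) := by
    have h₂ : mulLeft k (D h) = ∑ i ∈ (ℛ k h).index,
        TensorProduct.map (mulLeft k ((ℛ k h).left i)) (mulLeft k ((ℛ k h).right i)) := by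
      apply TensorProduct.ext'
      intro a b
      simp [D, ← (ℛ k h).eq, Finset.sum_mul]
    rw [h₂, map_sum, dualMul_repr _ _ (ℛ k h)]
    simp only [trace_tensorProduct', character_self_apply]
  have h₂ : e.conj (TensorProduct.map (mulLeft k h) LinearMap.id) = mulLeft k (D h) := by
    apply LinearMap.ext
    intro z
    obtain ⟨z, rfl⟩ := e.surjective z
    rw [LinearEquiv.conj_apply_apply, e.symm_apply_apply]
    change Θ _ = D h * Θ z
    induction z with
    | zero => simp
    | add x y hx hy => simp only [map_add, hx, hy, mul_add]
    | tmul a b => simp [hΘ, mul_assoc]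
  rw [h₁, ← h₂, trace_conj', trace_tensorProduct', trace_id, ← character_self_apply,
    LinearMap.smul_apply, smul_eq_mul, mul_comm]

theorem character_self_integral [Module.Finite k H] {t : H}
    (ht : IsIdempotentIntegral (⊤ : Subalgebra k H) t) : character k H H t = 1 := by
  have : mulLeft k t = (counit : Module.Dual k H).smulRight t := by
    ext x
    simp [ht.right _ trivial]
  rw [character_self_apply, this, trace_smulRight, ht.counit_eq_one]

end RegularCharacter

/-! ### The antipode is an involution -/

section AntipodeSquare

variable {k : Type u} {H : Type v} [Field k] [Ring H] [HopfAlgebra k H]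

theorem trace_eq_sum_integral [Module.Finite k H] {t : H}
    (ht : IsIdempotentIntegral (⊤ : Subalgebra k H) t) (f : H →ₗ[k] H) {ι : Type*}
    (r : Coalgebra.Repr k t ι) :
    trace k H f = ∑ i ∈ r.index, twistedTrace k H (r.right i * f (antipode k (r.left i))) := by
  have hf : f = ∑ i ∈ r.index, (rightHit (twistedTrace k H) (r.right i)).smulRight
      (f (antipode k (r.left i))) := by
    ext y
    conv_lhs => rw [← antipode_dualHit_leftHit_integral ht y, dualHit_repr _ r]
    simp
  conv_lhs => rw [hf]
  simp only [map_sum, trace_smulRight, rightHit_apply]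

/-- Moving p past S³ turns it into a right hit by q = p ∘ S³. The Nakayama automorphism then brings
each term to λ(S(t₁ ↼ q) t₂), where S * id cancels, and q(t) = p(t). -/
theorem trace_dualHit_comp_antipode_sq [Module.Finite k H] {t : H}
    (ht : IsIdempotentIntegral (⊤ : Subalgebra k H) t) (p : Module.Dual k H) :
    trace k H (dualHit p ∘ₗ antipode k ∘ₗ antipode k) = twistedTrace k H 1 * p t := by
  let q : Module.Dual k H := ((p ∘ₗ antipode k) ∘ₗ antipode k) ∘ₗ antipode k
  have h₁ : ∀ x, dualHit p (antipode k (antipode k (antipode k x))) =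
      antipode k (antipode k (antipode k (dualHitRight q x))) := fun x => by
    rw [dualHit_antipode, dualHitRight_antipode, dualHit_antipode]
  rw [trace_eq_sum_integral ht _ (ℛ k t)]
  simp only [LinearMap.comp_apply, h₁]
  have h₂ : conv (antipode k ∘ₗ dualHitRight q) LinearMap.id = scalarMap H q := by
    rw [← scalarMap_conv, conv_assoc, conv_antipode_id, conv_counit]
  have h₃ := congrArg (twistedTrace k H) (LinearMap.congr_fun h₂ t)
  rw [conv_repr _ _ (ℛ k t), map_sum] at h₃
  simp only [LinearMap.comp_apply, id_apply] at h₃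
  simp only [← twistedTrace_mul ht]
  rw [h₃, scalarMap_apply, Algebra.algebraMap_eq_smul_one, map_smul, smul_eq_mul, mul_comm]
  simp [q, antipode_integral ht]

/-- Write χ = λ(· b); nondegeneracy of χ makes b invertible. Since χ is symmetric and λ has Nakayama
automorphism S², x b = b S²(x). -/
theorem exists_antipode_sq_eq_conj [CharZero k] [IsSemisimpleRing H] [Module.Finite k H] {t : H}
    (ht : IsIdempotentIntegral (⊤ : Subalgebra k H) t) :
    ∃ a b : H, a * b = 1 ∧ b * a = 1 ∧ ∀ x, antipode k (antipode k x) = a * x * b := by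
  obtain ⟨b, hb⟩ := exists_eq_leftHit_twistedTrace ht (character k H H)
  have hb' : ∀ x, character k H H x = twistedTrace k H (x * b) := LinearMap.congr_fun hb
  have hinj : ∀ x, x * b = 0 → x = 0 := by
    intro x hx
    refine eq_zero_of_forall_character_self_eq_zero (k := k) fun y => ?_
    rw [hb', mul_assoc, hx, mul_zero, map_zero]
  have hsurj : Function.Surjective (mulRight k b) := by
    refine LinearMap.injective_iff_surjective.mp ?_
    rw [← ker_eq_bot, ker_eq_bot']
    exact hinj
  obtain ⟨a, ha⟩ := hsurj 1
  rw [mulRight_apply] at ha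
  have hba : b * a = 1 := by
    rw [← sub_eq_zero]
    apply hinj
    rw [sub_mul, mul_assoc, ha, mul_one, one_mul, sub_self]
  refine ⟨a, b, ha, hba, fun x => ?_⟩
  have h₁ : x * b = b * antipode k (antipode k x) := by
    have : leftHit (x * b) (twistedTrace k H) =
        leftHit (b * antipode k (antipode k x)) (twistedTrace k H) := by
      ext y
      rw [leftHit_apply, leftHit_apply, ← mul_assoc, ← hb', character_self_mul_comm, hb',
        mul_assoc, twistedTrace_mul ht, mul_assoc]
    rw [← antipode_dualHit_leftHit_integral ht (x * b), this,
      antipode_dualHit_leftHit_integral ht]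
  rw [mul_assoc, h₁, ← mul_assoc, ha, one_mul]

/-- λ(1) = tr S², and S² is conjugation by a. Radford's formula makes g a² central; with g^m = 1,
a^(2m) is central, and t serves as the central element on which a acts by a scalar. -/
theorem twistedTrace_one_ne_zero [CharZero k] [IsSemisimpleRing H] [Module.Finite k H] {t : H}
    (ht : IsIdempotentIntegral (⊤ : Subalgebra k H) t) : twistedTrace k H 1 ≠ 0 := by
  obtain ⟨a, b, hab, hba, hS⟩ := exists_antipode_sq_eq_conj ht
  obtain ⟨m, hm, hgm⟩ := exists_pow_dualHitRight_integral_eq_one ht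
  have hg := isGroupLikeElem_dualHitRight_integral ht
  have hS4 := mul_antipode_pow_four ht
  set g := dualHitRight (twistedTrace k H) t
  have hz : ∀ x, (g * a ^ 2) * x = x * (g * a ^ 2) := by
    intro x
    have h := congrArg (· * a ^ 2) (hS4 x)
    simp only [hS] at h
    have h' : g * (a * (a * x * b) * b) * a ^ 2 = g * a ^ 2 * x := by
      have : g * (a * (a * x * b) * b) * a ^ 2 = g * a ^ 2 * x * (b * (b * a) * a) := by
        noncomm_ring
      rw [this, hba, mul_one, hba, mul_one]
    rw [← h', h, mul_assoc]
  have hga : Commute g (antipode k g) := by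
    rw [Commute, SemiconjBy, hg.mul_antipode_cancel, hg.antipode_mul_cancel]
  have ha2 : a ^ 2 = antipode k g * (g * a ^ 2) := by
    rw [← mul_assoc, hg.antipode_mul_cancel, one_mul]
  have hcentral : ∀ x, a ^ (2 * m) * x = x * a ^ (2 * m) := by
    intro x
    have h₁ : a ^ (2 * m) = (g * a ^ 2) ^ m := by
      have h₂ : Commute (antipode k g) (g * a ^ 2) := (hz _).symm
      have h₃ : antipode k g ^ m = 1 := by
        have := hga.mul_pow m
        rw [hg.mul_antipode_cancel, one_pow, hgm, one_mul] at this
        exact this.symm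
      rw [pow_mul]
      conv_lhs => rw [ha2]
      rw [h₂.mul_pow, h₃, one_mul]
    rw [h₁]
    exact (show Commute (g * a ^ 2) x from hz x).pow_left m
  have h := trace_conj_ne_zero (isSeparabilityIdempotent_integral ht) hab (by positivity) hcentral
    ht.ne_zero (fun x => (ht.right x trivial).trans (ht.left x trivial).symm) (ht.left a trivial)
  have h₁ : mulLeft k a ∘ₗ mulRight k b = mulLeft k 1 ∘ₗ antipode k ∘ₗ antipode k := by
    ext x
    simp [hS, mul_assoc]
  rw [twistedTrace_apply, ← h₁]
  exact h

/-- The defining relation of g at h = 1 reads λ(1) 1 = λ(1) g, so g = 1. -/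
theorem dualHitRight_twistedTrace_eq [CharZero k] [IsSemisimpleRing H] [Module.Finite k H] {t : H}
    (ht : IsIdempotentIntegral (⊤ : Subalgebra k H) t) :
    dualHitRight (twistedTrace k H) = scalarMap H (twistedTrace k H) := by
  have hR := dualHitRight_twistedTrace ht
  have h1 := hR 1
  have h2 : dualHitRight (twistedTrace k H) 1 = twistedTrace k H 1 • 1 := by
    simp [dualHitRight, Algebra.TensorProduct.one_def]
  rw [h2] at h1
  have h3 := smul_right_injective H (twistedTrace_one_ne_zero ht) h1
  ext x
  rw [hR, ← h3, scalarMap_apply, Algebra.algebraMap_eq_smul_one]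

theorem antipode_pow_four [CharZero k] [IsSemisimpleRing H] [Module.Finite k H] {t : H}
    (ht : IsIdempotentIntegral (⊤ : Subalgebra k H) t) (x : H) :
    antipode k (antipode k (antipode k (antipode k x))) = x := by
  have h := mul_antipode_pow_four ht x
  rwa [dualHitRight_twistedTrace_eq ht, scalarMap_apply, twistedTrace_integral ht, map_one, one_mul,
    mul_one] at h

/-- An involution `σ` of an `n`-dimensional space with nonzero trace and a nonzero fixed vector is
the identity if it commutes with some `P` such that `P² = n P` and `tr (P σ) = tr σ`. -/
theorem eq_one_of_trace_eq {K V : Type*} [Field K] [CharZero K] [AddCommGroup V] [Module K V]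
    [Module.Finite K V] {σ P : Module.End K V} (hσ : σ * σ = 1)
    (hP : P * P = (Module.finrank K V : K) • P) (hcomm : P * σ = σ * P)
    (htr : trace K V (P * σ) = trace K V σ) (h0 : trace K V σ ≠ 0) {v : V} (hv : v ≠ 0)
    (hσv : σ v = v) : σ = 1 := by
  have hnt : Nontrivial V := ⟨v, 0, hv⟩
  have hn : 0 < Module.finrank K V := Module.finrank_pos
  set n := Module.finrank K V with hn_def
  have hn0 : (n : K) ≠ 0 := by exact_mod_cast hn.ne'
  have h2 : (2 : K) ≠ 0 := two_ne_zero
  let E : Module.End K V := (2 : K)⁻¹ • (1 + σ)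
  let Q : Module.End K V := (n : K)⁻¹ • P
  have hσE : σ = (2 : K) • E - 1 := by
    simp only [E, smul_smul, mul_inv_cancel₀ h2, one_smul]; abel
  have hPQ : P = (n : K) • Q := by
    simp only [Q, smul_smul, mul_inv_cancel₀ hn0, one_smul]
  have hE : E * E = E := by
    have : (1 + σ) * (1 + σ) = (2 : K) • (1 + σ) := by
      rw [mul_add, add_mul, add_mul, hσ, two_smul]; simp; abel
    simp only [E, smul_mul_smul_comm, this, smul_smul]
    congr 1
    field_simp
  have hQ : Q * Q = Q := by
    simp only [Q, smul_mul_smul_comm, hP, smul_smul]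
    congr 1
    field_simp
  have hQE : Q * E = E * Q := by
    simp only [E, Q, smul_mul_smul_comm, mul_add, add_mul, hcomm, mul_one, one_mul,
      mul_comm (2 : K)⁻¹]
  have hQE' : IsIdempotentElem (Q * E) := by
    rw [IsIdempotentElem, mul_assoc, ← mul_assoc E, ← hQE, mul_assoc Q E E, hE, ← mul_assoc, hQ]
  obtain ⟨e, hen, he⟩ := exists_trace_eq_natCast_of_isIdempotentElem hE
  obtain ⟨q, -, hq⟩ := exists_trace_eq_natCast_of_isIdempotentElem hQ
  obtain ⟨r, -, hr⟩ := exists_trace_eq_natCast_of_isIdempotentElem hQE'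
  have hE0 : E ≠ 0 := by
    intro h
    have h' := LinearMap.congr_fun h v
    simp only [E, LinearMap.smul_apply, LinearMap.add_apply, hσv, Module.End.one_apply,
      LinearMap.zero_apply] at h'
    rw [← two_smul K v, smul_smul, inv_mul_cancel₀ h2, one_smul] at h'
    exact hv h'
  have he0 : e ≠ 0 := by
    rintro rfl
    rw [Nat.cast_zero, IsIdempotentElem.trace_eq_zero_iff hE] at he
    exact hE0 he
  have htrσ : trace K V σ = 2 * e - n := by
    rw [hσE, map_sub, map_smul, he, trace_one, smul_eq_mul]
  have htrP : trace K V (P * σ) = n * (2 * r - q) := by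
    rw [hPQ, hσE, smul_mul_assoc, mul_sub, mul_smul_comm, mul_one, map_smul, map_sub, map_smul, hr,
      hq, smul_eq_mul, smul_eq_mul]
  rw [htrP, htrσ] at htr
  rw [htrσ] at h0
  have hZ : (n : ℤ) * (2 * r - q) = 2 * e - n := by exact_mod_cast htr
  have h0Z : (2 * e - n : ℤ) ≠ 0 := by exact_mod_cast h0
  have hen' : e = n := by
    -- w = 2e/n, where e is the multiplicity of the eigenvalue 1 of σ. As 0 < e ≤ n, w is 1 or 2,
    -- and w = 1 would make tr σ = 2e - n vanish.
    set w : ℤ := 2 * r - q + 1 with hw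
    have hw' : (n : ℤ) * w = 2 * e := by rw [hw]; linarith
    have hw2 : w ≤ 2 := by nlinarith
    have hw0 : 0 < w := by
      have : (0 : ℤ) < e := by exact_mod_cast Nat.pos_of_ne_zero he0
      nlinarith
    interval_cases w
    · exact absurd (by linarith) h0Z
    · have : (e : ℤ) = n := by linarith
      exact_mod_cast this
  have hE1 : (1 : Module.End K V) - E = 0 := by
    have h₁ : IsIdempotentElem (1 - E) := IsIdempotentElem.one_sub hE
    rw [← IsIdempotentElem.trace_eq_zero_iff h₁, map_sub, he, trace_one, hen', sub_self]
  rw [hσE, ← sub_eq_zero.mp hE1, two_smul]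
  abel

/-- **Larson–Radford**: the antipode of a semisimple Hopf algebra in characteristic zero is an
involution. -/
theorem antipode_antipode [CharZero k] [IsSemisimpleRing H] (x : H) :
    antipode k (antipode k x) = x := by
  obtain ⟨t, ht⟩ := exists_isIdempotentIntegral_top k H
  have := (isSeparabilityIdempotent_integral ht).finite
  obtain ⟨a, b, hab, hba, hS⟩ := exists_antipode_sq_eq_conj ht
  let σ : Module.End k H := antipode k ∘ₗ antipode k
  let P : Module.End k H := dualHit (character k H H)
  have hσ : σ * σ = 1 := by
    ext x
    exact antipode_pow_four ht x
  have hP : P * P = (Module.finrank k H : k) • P := by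
    change dualHit _ ∘ₗ dualHit _ = (Module.finrank k H : k) • dualHit (character k H H)
    rw [dualHit_comp_dualHit, dualMul_character_self]
    ext x
    simp [dualHit_repr _ (ℛ k x), Finset.smul_sum, smul_smul]
  have hχ : (character k H H ∘ₗ antipode k) ∘ₗ antipode k = character k H H := by
    ext x
    rw [LinearMap.comp_apply, LinearMap.comp_apply, hS, character_self_mul_comm, ← mul_assoc, hba,
      one_mul]
  have hcomm : P * σ = σ * P := by
    ext x
    change dualHit _ (antipode k (antipode k x)) = antipode k (antipode k (dualHit _ x))
    rw [dualHit_antipode, dualHitRight_antipode, hχ]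
  have htσ : trace k H σ = twistedTrace k H 1 := by
    rw [twistedTrace_apply, mulLeft_one, id_comp]
  have htP : trace k H (P * σ) = trace k H σ := by
    rw [htσ]
    refine (trace_dualHit_comp_antipode_sq ht _).trans ?_
    rw [character_self_integral ht, mul_one]
  have hone : (1 : H) ≠ 0 := by
    intro h
    apply ht.ne_zero
    rw [← mul_one t, h, mul_zero]
  have h1 : σ = 1 := eq_one_of_trace_eq hσ hP hcomm htP
    (htσ ▸ twistedTrace_one_ne_zero ht) hone (by simp [σ, antipode_one])
  exact LinearMap.congr_fun h1 x

theorem twistedTrace_eq_character [CharZero k] [IsSemisimpleRing H] :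
    twistedTrace k H = character k H H := by
  ext x
  rw [twistedTrace_apply, character_self_apply]
  congr 1
  ext y
  simp [antipode_antipode]

end AntipodeSquare

/-! ### Left coideal subalgebras: trace form, integrals, projection -/

section LeftCoideal

/-- Fitting decomposition: with minimal polynomial X^a r and f X^(a+1) + g r = 1, the element f
X^(a+1) at x is an idempotent of trace 0, hence 0. If ε(x) ≠ 0, then ε(x) is a root of r, and
applying ε to the Bézout identity gives 0 = 1. -/
theorem algHom_eq_zero_of_character_self_mul_eq_zero {k A : Type*} [Field k] [CharZero k] [Ring A]
    [Algebra k A] [Module.Finite k A] (ε : A →ₐ[k] k) {x : A}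
    (hx : ∀ p : Polynomial k, character k A A (x * Polynomial.aeval x p) = 0) : ε x = 0 := by
  open Polynomial in
  by_contra hε
  have hμ : minpoly k x ≠ 0 := minpoly.ne_zero (Algebra.IsIntegral.isIntegral x)
  obtain ⟨r, hr, hrX⟩ := exists_eq_pow_rootMultiplicity_mul_and_not_dvd _ hμ 0
  rw [C_0, sub_zero] at hr hrX
  set a := (minpoly k x).rootMultiplicity 0
  have hcop : IsCoprime (X ^ (a + 1)) r :=
    ((prime_X.irreducible.coprime_iff_not_dvd).mpr hrX).pow_left
  obtain ⟨f, g, hfg⟩ := hcop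
  have hidem : aeval x (f * X ^ (a + 1)) * aeval x (f * X ^ (a + 1)) =
      aeval x (f * X ^ (a + 1)) := by
    have h₁ : f * X ^ (a + 1) * (f * X ^ (a + 1)) =
        f * X ^ (a + 1) - f * g * X * minpoly k x := by
      rw [hr]
      linear_combination (f * X ^ (a + 1)) * hfg
    rw [← map_mul, h₁, map_sub, map_mul _ _ (minpoly k x), minpoly.aeval, mul_zero, sub_zero]
  have h0 : aeval x (f * X ^ (a + 1)) = 0 := by
    refine eq_zero_of_character_self_idempotent (k := k) hidem ?_
    have : f * X ^ (a + 1) = X * (f * X ^ a) := by ring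
    rw [this, map_mul, aeval_X, hx]
  have h₂ : ∀ p : k[X], ε (aeval x p) = p.eval (ε x) := fun p => by
    rw [← aeval_algHom_apply, coe_aeval_eq_eval]
  have h₃ : (minpoly k x).eval (ε x) = 0 := by rw [← h₂, minpoly.aeval, map_zero]
  rw [hr, eval_mul, eval_pow, eval_X] at h₃
  have h₄ := (mul_eq_zero.mp h₃).resolve_left (pow_ne_zero _ hε)
  have h₅ := h₂ (f * X ^ (a + 1))
  rw [h0, map_zero] at h₅
  have h₆ := congrArg (eval (ε x)) hfg
  rw [eval_add, ← h₅, eval_mul, h₄, eval_one] at h₆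
  simp at h₆

variable {k : Type u} {H : Type v} [Field k] [Ring H] [HopfAlgebra k H]

theorem IsLeftCoideal.exists_repr {N : Subalgebra k H} (hN : IsLeftCoideal N) {n : H}
    (hn : n ∈ N) : ∃ r : Coalgebra.Repr k n (H × N), ∀ i, r.right i ∈ N := by
  classical
  obtain ⟨z, hz⟩ := hN n hn
  obtain ⟨s, hs⟩ := TensorProduct.exists_finset z
  refine ⟨⟨s, fun i => i.1, fun i => (i.2 : H), ?_⟩, fun i => i.2.2⟩
  rw [← hz, hs]
  simp

theorem IsLeftCoideal.dualHitRight_mem {N : Subalgebra k H} (hN : IsLeftCoideal N) {n : H}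
    (hn : n ∈ N) (q : Module.Dual k H) : dualHitRight q n ∈ N := by
  obtain ⟨r, hr⟩ := hN.exists_repr hn
  rw [dualHitRight_repr q r]
  exact N.sum_mem fun i _ => N.smul_mem (hr i) _

theorem IsLeftCoideal.dualHit_congr {N : Subalgebra k H} (hN : IsLeftCoideal N)
    {p q : Module.Dual k H} (hpq : ∀ n ∈ N, p n = q n) {n : H} (hn : n ∈ N) :
    dualHit p n = dualHit q n := by
  obtain ⟨r, hr⟩ := hN.exists_repr hn
  rw [dualHit_repr p r, dualHit_repr q r]
  exact Finset.sum_congr rfl fun i _ => by rw [hpq _ (hr i)]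

variable (k H) in
theorem module_finite_of_isSemisimpleRing [IsSemisimpleRing H] : Module.Finite k H := by
  obtain ⟨t, ht⟩ := exists_isIdempotentIntegral_top k H
  exact (isSeparabilityIdempotent_integral ht).finite

variable [CharZero k] [IsSemisimpleRing H]

theorem dualHit_character_self :
    dualHit (character k H H) = scalarMap H (character k H H) := by
  have := module_finite_of_isSemisimpleRing k H
  rw [← twistedTrace_eq_character, dualHit_twistedTrace]

theorem dualHitRight_character_self :
    dualHitRight (character k H H) = scalarMap H (character k H H) := by
  have := module_finite_of_isSemisimpleRing k H
  obtain ⟨t, ht⟩ := exists_isIdempotentIntegral_top k H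
  rw [← twistedTrace_eq_character, dualHitRight_twistedTrace_eq ht]

/-- The trace form of `H` restricts to a nondegenerate form on a left coideal subalgebra. -/
theorem IsLeftCoideal.eq_zero_of_forall_character {N : Subalgebra k H} (hN : IsLeftCoideal N)
    {x : H} (hx : x ∈ N) (h0 : ∀ y ∈ N, character k H H (x * y) = 0) : x = 0 := by
  have := module_finite_of_isSemisimpleRing k H
  have hε : ∀ z ∈ N, (∀ y ∈ N, character k H H (z * y) = 0) → counit (R := k) z = 0 := by
    intro z hz hz0
    refine algHom_eq_zero_of_character_self_mul_eq_zero (Bialgebra.counitAlgHom k H)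
      fun p => hz0 _ ?_
    exact Polynomial.aeval_mem_adjoin_singleton k z |> Algebra.adjoin_le (by simpa using hz)
  rw [← Module.forall_dual_apply_eq_zero_iff k]
  intro q
  rw [← counit_dualHitRight]
  refine hε _ (hN.dualHitRight_mem hx q) fun y hy => ?_
  -- S maps ∑ x₁ χ(x₂ y) to ∑ y₁ χ(x y₂), which is 0 because Δ(y) ∈ H ⊗ N. So the radical is stable
  -- under x ↦ x ↼ q, and q(x) = ε(x ↼ q) = 0 for every q.
  have h₁ : dualHit (leftHit y (character k H H)) x = 0 := by
    rw [← antipode_antipode (k := k) (dualHit (leftHit y (character k H H)) x),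
      antipode_dualHit_leftHit dualHit_character_self,
      hN.dualHit_congr (q := 0) (fun n hn => h0 n hn) hy]
    simp [dualHit]
  have h₂ := congrArg q h₁
  rw [dualHit_repr _ (ℛ k x), map_zero] at h₂
  rw [dualHitRight_repr _ (ℛ k x), Finset.sum_mul, map_sum, ← h₂, map_sum]
  refine Finset.sum_congr rfl fun i _ => ?_
  rw [smul_mul_assoc, map_smul, map_smul, leftHit_apply, smul_eq_mul, smul_eq_mul, mul_comm]

theorem IsLeftCoideal.exists_dual_eq_character {N : Subalgebra k H} (hN : IsLeftCoideal N)
    (p : Module.Dual k N) : ∃ y ∈ N, ∀ n : N, p n = character k H H (y * n) := by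
  have := module_finite_of_isSemisimpleRing k H
  let F : N →ₗ[k] Module.Dual k N :=
    (((LinearMap.mul k H).compr₂ (character k H H)).compl₁₂ N.val.toLinearMap N.val.toLinearMap)
  have hinj : Function.Injective F := by
    rw [← ker_eq_bot, ker_eq_bot']
    intro y hy
    exact Subtype.ext (hN.eq_zero_of_forall_character y.2
      fun n hn => LinearMap.congr_fun hy ⟨n, hn⟩)
  obtain ⟨y, hy⟩ := (LinearMap.injective_iff_surjective_of_finrank_eq_finrank
    (Subspace.dual_finrank_eq (K := k) (V := N)).symm).mp hinj p
  exact ⟨y, y.2, fun n => by rw [← hy]; rfl⟩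

theorem IsLeftCoideal.eq_of_forall_character {N : Subalgebra k H} (hN : IsLeftCoideal N)
    {x y : H} (hx : x ∈ N) (hy : y ∈ N)
    (h : ∀ n ∈ N, character k H H (x * n) = character k H H (y * n)) : x = y := by
  rw [← sub_eq_zero]
  refine hN.eq_zero_of_forall_character (N.sub_mem hx hy) fun n hn => ?_
  rw [sub_mul, map_sub, h n hn, sub_self]

/-- The s ∈ N representing ε in the trace form is a two-sided integral, as χ is symmetric. If ε(s) =
0, then s² = 0 and χ(s) = 0, contradicting χ(s) = ε(1) = 1; so s can be normalised. -/
theorem IsLeftCoideal.exists_isIdempotentIntegral {N : Subalgebra k H} (hN : IsLeftCoideal N) :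
    ∃ t : H, IsIdempotentIntegral N t := by
  have := module_finite_of_isSemisimpleRing k H
  obtain ⟨s, hs, hsN⟩ := hN.exists_dual_eq_character (counit ∘ₗ N.val.toLinearMap)
  have hsN' : ∀ n ∈ N, character k H H (s * n) = counit (R := k) n :=
    fun n hn => (hsN ⟨n, hn⟩).symm
  have hr : ∀ n ∈ N, s * n = counit (R := k) n • s := fun n hn =>
    hN.eq_of_forall_character (N.mul_mem hs hn) (N.smul_mem hs _) fun m hm => by
      rw [mul_assoc, hsN' _ (N.mul_mem hn hm), smul_mul_assoc, map_smul, hsN' m hm,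
        Bialgebra.counit_mul, smul_eq_mul]
  have hl : ∀ n ∈ N, n * s = counit (R := k) n • s := fun n hn =>
    hN.eq_of_forall_character (N.mul_mem hn hs) (N.smul_mem hs _) fun m hm => by
      rw [mul_assoc, character_self_mul_comm, mul_assoc, hsN' _ (N.mul_mem hm hn), smul_mul_assoc,
        map_smul, hsN' m hm, Bialgebra.counit_mul, smul_eq_mul, mul_comm]
  have hε : counit (R := k) s ≠ 0 := by
    intro h0
    have h₁ : IsNilpotent (mulLeft k s) := by
      refine ⟨2, ?_⟩
      rw [pow_mulLeft, pow_two, hl s hs, h0, zero_smul, mulLeft_zero_eq_zero]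
    have h₂ := (LinearMap.isNilpotent_trace_of_isNilpotent h₁).eq_zero
    rw [← character_self_apply, ← mul_one s, hsN' 1 N.one_mem, Bialgebra.counit_one] at h₂
    exact one_ne_zero h₂
  have hs0 : s ≠ 0 := by
    rintro rfl
    simp at hε
  refine ⟨(counit (R := k) s)⁻¹ • s, N.smul_mem hs _, smul_ne_zero (inv_ne_zero hε) hs0, ?_,
    fun n hn => ?_, fun n hn => ?_⟩
  · rw [smul_mul_smul_comm, hl s hs, smul_smul, mul_assoc, inv_mul_cancel₀ hε, mul_one]
  · rw [mul_smul_comm, hl n hn, smul_comm]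
  · rw [smul_mul_assoc, hr n hn, smul_comm]

section Integral

variable {N : Subalgebra k H} (hN : IsLeftCoideal N) {t : H} (ht : IsIdempotentIntegral N t)
include hN ht

omit [CharZero k] [IsSemisimpleRing H] in
theorem dualHit_rightHit_integral_of_mem {y : H} (hy : y ∈ N) :
    dualHit (rightHit (character k H H) t) y = character k H H t • y := by
  rw [hN.dualHit_congr (q := character k H H t • counit) _ hy]
  · have h := LinearMap.congr_fun (dualHit_counit (k := k) (H := H)) y
    rw [dualHit_repr _ (ℛ k y), id_apply] at h
    conv_rhs => rw [← h]
    simp [dualHit_repr _ (ℛ k y), Finset.smul_sum, smul_smul]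
  · intro n hn
    rw [rightHit_apply, ht.right n hn, map_smul, LinearMap.smul_apply, smul_eq_mul, smul_eq_mul,
      mul_comm]

theorem antipode_dualHit_leftHit_of_mem {y : H} (hy : y ∈ N) :
    antipode k (dualHit (leftHit y (character k H H)) t) = character k H H t • y := by
  rw [antipode_dualHit_leftHit dualHit_character_self, dualHit_rightHit_integral_of_mem hN ht hy]

/-- Here y is the orthogonal projection of h to N. Applying S exchanges h and t; then Δ(t) ∈ H ⊗ N
allows h to be replaced by y, where the integral property of t applies. -/
theorem dualHit_leftHit_integral_eq {h y : H} (hy : y ∈ N)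
    (hhy : ∀ n ∈ N, character k H H (h * n) = character k H H (y * n)) :
    dualHit (leftHit t (character k H H)) h = character k H H t • y := by
  rw [← antipode_antipode (k := k) (dualHit _ h), antipode_dualHit_leftHit dualHit_character_self,
    ← antipode_dualHit_leftHit_of_mem hN ht hy]
  congr 1
  refine hN.dualHit_congr (fun n hn => ?_) ht.mem
  rw [rightHit_apply, leftHit_apply, hhy n hn, character_self_mul_comm]

theorem dualHit_leftHit_integral_mem (h : H) :
    dualHit (leftHit t (character k H H)) h ∈ N := by
  obtain ⟨y, hy, hyN⟩ := hN.exists_dual_eq_character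
    (rightHit (character k H H) h ∘ₗ N.val.toLinearMap)
  rw [dualHit_leftHit_integral_eq hN ht hy fun n hn => hyN ⟨n, hn⟩]
  exact N.smul_mem hy _

theorem isDualIntegral_leftHit_integral :
    IsDualIntegral (dualInvariants N) (leftHit t (character k H H)) := by
  have := module_finite_of_isSemisimpleRing k H
  refine ⟨fun n hn => ?_, fun h0 => ?_, fun b hb => ?_, fun b hb => ?_⟩
  · ext h
    rw [leftHit_apply, leftHit_apply, mul_assoc, ht.left n hn, mul_smul_comm, map_smul]
    rfl
  · have h := LinearMap.congr_fun h0 1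
    rw [leftHit_apply, one_mul, LinearMap.zero_apply] at h
    exact ht.ne_zero (eq_zero_of_character_self_idempotent ht.idem h)
  · ext h
    have hm := dualHit_leftHit_integral_mem hN ht h
    have h₁ := LinearMap.congr_fun (hb _ hm) 1
    rw [leftHit_apply, one_mul, LinearMap.smul_apply, dualHit_apply_of_counit] at h₁
    rw [dualMul_apply, h₁, LinearMap.smul_apply, smul_eq_mul, smul_eq_mul, mul_comm]
  · have hb' : ∀ x, ∀ n ∈ N, b (x * n) = counit (R := k) n * b x := fun x n hn =>
      LinearMap.congr_fun (hb n hn) x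
    ext h
    obtain ⟨r, hr⟩ := hN.exists_repr ht.mem
    -- As t₂ ∈ N and b is N-invariant, b absorbs t₂ through ε, leaving ∑ χ(h₁ t) b(h₂). The left
    -- side equals χ(h t) b(1) by invariance of χ.
    have h₁ : b (dualHitRight (character k H H) (h * t)) =
        dualMul (leftHit t (character k H H)) b h := by
      have h₂ : ∀ i, ∑ j ∈ r.index, b ((ℛ k h).right i * r.right j) *
          character k H H ((ℛ k h).left i * r.left j) =
          b ((ℛ k h).right i) * character k H H ((ℛ k h).left i * t) := by
        intro i
        have h₃ := LinearMap.congr_fun (dualHit_counit (k := k) (H := H)) t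
        rw [dualHit_repr _ r, id_apply] at h₃
        conv_rhs => rw [← h₃]
        simp only [hb' _ _ (hr _), Finset.mul_sum, mul_smul_comm, map_sum, map_smul, smul_eq_mul]
        exact Finset.sum_congr rfl fun j _ => by ring
      rw [dualMul_repr _ _ (ℛ k h), dualHitRight]
      simp only [LinearMap.comp_apply, Bialgebra.comul_mul]
      rw [← r.eq, ← (ℛ k h).eq, Finset.sum_mul_sum]
      simp only [map_sum, Algebra.TensorProduct.tmul_mul_tmul, rTensor_tmul,
        LinearEquiv.coe_coe, TensorProduct.lid_tmul, map_smul, smul_eq_mul, leftHit_apply]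
      refine Finset.sum_congr rfl fun i _ => ?_
      rw [mul_comm, ← h₂]
      exact Finset.sum_congr rfl fun j _ => mul_comm _ _
    rw [← h₁, dualHitRight_character_self, scalarMap_apply, Algebra.algebraMap_eq_smul_one,
      map_smul, LinearMap.smul_apply, leftHit_apply, smul_eq_mul, smul_eq_mul, mul_comm]

end Integral

end LeftCoideal

/-! ### Characters of induced modules -/

section Induction

variable {k : Type u} {H : Type v} [Field k] [Ring H] [HopfAlgebra k H]

variable (k) in
/-- The left adjoint action `x ↦ ∑ h₁ x S(h₂)`. -/
noncomputable def adjointAction (h : H) : H →ₗ[k] H :=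
  ∑ i ∈ (ℛ k h).index, mulLeft k ((ℛ k h).left i) ∘ₗ mulRight k (antipode k ((ℛ k h).right i))

theorem coad_eq_comp_adjointAction (h : H) (p : Module.Dual k H) :
    coad h p = p ∘ₗ adjointAction k h := by
  ext x
  rw [coad]
  conv_lhs => rw [← (ℛ k h).eq]
  simp [adjointAction]

theorem gamma_apply (N : Subalgebra k H) (l : Module.Dual k H) (hl : ∀ h, dualHit l h ∈ N)
    (p : Module.Dual k N) (h : H) : gamma N l hl p h = p ⟨dualHit l h, hl h⟩ := rfl

/-- e factors through a section σ of M → M ⧸ P, and cyclicity of the trace moves the computation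
from M ⧸ P to M. -/
theorem character_quotient_eq {A M : Type*} [Ring A] [Algebra k A] [AddCommGroup M] [Module k M]
    [Module A M] [IsScalarTower k A M] [Module.Finite k M] (P : Submodule A M) (e : M →ₗ[A] M)
    (hker : P ≤ ker e) (he : ∀ m, P.mkQ (e m) = P.mkQ m) (x : A) :
    character k A (M ⧸ P) x = trace k M (Algebra.lsmul k k M x ∘ₗ e.restrictScalars k) := by
  let π : M →ₗ[k] M ⧸ P := P.mkQ.restrictScalars k
  have hsurj : Function.Surjective π := P.mkQ_surjective
  have hfin : Module.Finite k (M ⧸ P) := Module.Finite.of_surjective π hsurj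
  let σ : M ⧸ P →ₗ[k] M := (P.liftQ e hker).restrictScalars k
  have hσ : σ ∘ₗ π = e.restrictScalars k := rfl
  have hπ : π ∘ₗ e.restrictScalars k = π := LinearMap.ext he
  have h₁ : (Algebra.lsmul k k (M ⧸ P) x).comp π = π.comp (Algebra.lsmul k k M x) := rfl
  have h₂ : (Algebra.lsmul k k (M ⧸ P) x : M ⧸ P →ₗ[k] M ⧸ P) =
      π ∘ₗ (Algebra.lsmul k k M x ∘ₗ σ) := by
    refine (cancel_right hsurj).mp ?_
    rw [comp_assoc, comp_assoc, hσ, ← comp_assoc, ← h₁, comp_assoc, hπ]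
  rw [character_apply, h₂, trace_comp_comm', comp_assoc, hσ]

section

variable [CharZero k] [IsSemisimpleRing H]

/-- By z = ∑ χ(z t₁) S(t₂), the map z ↦ x z y is a sum of rank-one maps with trace ∑ χ(x S(t₂) y
t₁); symmetry of χ rotates t₁ to the front. -/
theorem trace_mulLeft_comp_mulRight {t : H} (ht : IsIdempotentIntegral (⊤ : Subalgebra k H) t)
    (x y : H) : trace k H (mulLeft k x ∘ₗ mulRight k y) =
      character k H H (adjointAction k t x * y) := by
  have := module_finite_of_isSemisimpleRing k H
  let r := ℛ k t
  have h₁ : ∀ z, ∑ i ∈ r.index, character k H H (z * r.left i) • antipode k (r.right i) = z := by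
    intro z
    have h := antipode_dualHitRight_rightHit (dualHitRight_character_self (k := k) (H := H)) z t
    have h₂ : leftHit t (character k H H) = counit := by
      ext y
      rw [leftHit_apply, ht.left y trivial, map_smul, character_self_integral ht, smul_eq_mul,
        mul_one]
    rw [h₂, dualHitRight_counit, id_apply, dualHitRight_repr _ r, map_sum] at h
    simpa using h
  have h₂ : mulLeft k x ∘ₗ mulRight k y = ∑ i ∈ r.index,
      (leftHit (r.left i) (character k H H)).smulRight (x * (antipode k (r.right i) * y)) := by
    ext z
    conv_lhs => rw [← h₁ z]
    simp
  rw [h₂, map_sum, adjointAction, LinearMap.sum_apply, Finset.sum_mul, map_sum]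
  refine Finset.sum_congr rfl fun i _ => ?_
  rw [trace_smulRight, leftHit_apply, character_self_mul_comm]
  simp [r, mul_assoc]

/-- Dual bases of a left coideal subalgebra for the restriction of the trace form. -/
theorem IsLeftCoideal.exists_dualBases {N : Subalgebra k H} (hN : IsLeftCoideal N) :
    ∃ (n : ℕ) (b d : Fin n → N),
      (∀ y : N, ∑ i, character k H H (d i * y : H) • b i = y) ∧
      (∀ y : N, ∑ i, character k H H (b i * y : H) • d i = y) := by
  have := module_finite_of_isSemisimpleRing k H
  let b := Module.finBasis k N
  choose d hd hdb using fun i => hN.exists_dual_eq_character (b.coord i)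
  refine ⟨_, b, fun i => ⟨d i, hd i⟩, fun y => ?_, fun y => ?_⟩
  · simp only [← hdb]
    exact b.sum_repr y
  · refine Subtype.ext (hN.eq_of_forall_character (Subtype.prop _) y.2 fun n hn => ?_)
    let χN : N →ₗ[k] k := character k H H ∘ₗ mulLeft k (y : H) ∘ₗ N.val.toLinearMap
    let θN : N →ₗ[k] k := character k H H ∘ₗ
      mulLeft k ((∑ i, character k H H (b i * y : H) • (⟨d i, hd i⟩ : N) : N) : H) ∘ₗ
        N.val.toLinearMap
    have h : θN = χN := by
      refine b.ext fun j => ?_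
      have h₁ : ∀ i, character k H H (d i * b j) = b.coord i (b j) := fun i => (hdb i _).symm
      simp only [χN, θN, LinearMap.comp_apply, mulLeft_apply, AddSubmonoidClass.coe_finsetSum,
        Finset.sum_mul, map_sum, SetLike.val_smul, smul_mul_assoc, map_smul, smul_eq_mul,
        AlgHom.toLinearMap_apply, Subalgebra.coe_val, h₁, Module.Basis.coord_apply,
        Module.Basis.repr_self]
      rw [Finset.sum_eq_single j]
      · simp [character_self_mul_comm]
      · intro i _ hi
        simp [hi.symm]
      · simp
    exact LinearMap.congr_fun h ⟨n, hn⟩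

/-- The `H`-linear endomorphism `h ⊗ v ↦ c ∑ h dᵢ ⊗ bᵢ v` of `H ⊗ V`. -/
noncomputable def inducedProjection {N : Subalgebra k H} {n : ℕ} (c : k) (b d : Fin n → N)
    (V : Type*) [AddCommGroup V] [Module k V] [Module N V] [IsScalarTower k N V] :
    H ⊗[k] V →ₗ[H] H ⊗[k] V :=
  c • ∑ i, TensorProduct.AlgebraTensorModule.map (LinearMap.toSpanSingleton H H (d i : H))
    (Algebra.lsmul k k V (b i))

omit [CharZero k] [IsSemisimpleRing H] in
theorem inducedProjection_tmul {N : Subalgebra k H} {n : ℕ} (c : k) (b d : Fin n → N)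
    (V : Type*) [AddCommGroup V] [Module k V] [Module N V] [IsScalarTower k N V] (h : H) (v : V) :
    inducedProjection c b d V (h ⊗ₜ v) = c • ∑ i, (h * d i) ⊗ₜ[k] (b i • v) := by
  simp [inducedProjection]

section Bases

variable {N : Subalgebra k H} (hN : IsLeftCoideal N) {n : ℕ} {b d : Fin n → N}
  (hb : ∀ y : N, ∑ i, character k H H (d i * y : H) • b i = y)
  (hd : ∀ y : N, ∑ i, character k H H (b i * y : H) • d i = y)
include hb hd

omit [CharZero k] [IsSemisimpleRing H] in
-- Expand y dᵢ in the dⱼ and bⱼ y in the bᵢ: the coefficients χ(bⱼ y dᵢ) and χ(dᵢ bⱼ y) agree by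
-- symmetry. This makes `inducedProjection` vanish on the relations of H ⊗_N V.
theorem sum_mul_dualBases_comm {M : Type*} [AddCommGroup M] [Module k M] (f : N →ₗ[k] N →ₗ[k] M)
    (y : N) : ∑ i, f (y * d i) (b i) = ∑ i, f (d i) (b i * y) := by
  have h₁ : ∀ i, f (y * d i) (b i) =
      ∑ j, character k H H (b j * (y * d i : N) : H) • f (d j) (b i) := fun i => by
    conv_lhs => rw [← hd (y * d i)]
    simp
  have h₂ : ∀ j, f (d j) (b j * y) =
      ∑ i, character k H H (d i * (b j * y : N) : H) • f (d j) (b i) := fun j => by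
    conv_lhs => rw [← hb (b j * y)]
    simp
  simp only [h₁, h₂]
  rw [Finset.sum_comm]
  refine Finset.sum_congr rfl fun j _ => Finset.sum_congr rfl fun i _ => ?_
  rw [character_self_mul_comm (d i : H)]
  simp [mul_assoc]

include hN in
omit hb in
theorem dualHit_leftHit_integral_eq_sum {t : H} (ht : IsIdempotentIntegral N t) (h : H) :
    dualHit (leftHit t (character k H H)) h =
      character k H H t • ((∑ i, character k H H (d i * h) • b i : N) : H) := by
  refine dualHit_leftHit_integral_eq hN ht (Subtype.prop _) fun m hm => ?_
  conv_lhs => rw [character_self_mul_comm]; arg 2; arg 1; change ((⟨m, hm⟩ : N) : H); rw [← hd ⟨m, hm⟩]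
  simp only [AddSubmonoidClass.coe_finsetSum, Finset.sum_mul, map_sum, SetLike.val_smul,
    smul_mul_assoc, map_smul, smul_eq_mul]
  exact Finset.sum_congr rfl fun j _ => mul_comm _ _

include hN in
omit hd in
-- In ∑ S(t₁) t₂ = ε(t) = 1, expand t₂ ∈ N in the bᵢ; the coefficient of bᵢ is ∑ χ(dᵢ t₂) S(t₁) =
-- χ(t) dᵢ. So `inducedProjection` is the identity modulo the relations.
theorem sum_dualBases_mul {t : H} (ht : IsIdempotentIntegral N t) :
    character k H H t • ∑ i, d i * b i = 1 := by
  obtain ⟨r, hr⟩ := hN.exists_repr ht.mem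
  have h₁ := sum_antipode_mul_eq_smul (R := k) r
  rw [ht.counit_eq_one, one_smul] at h₁
  have h₂ : ∀ s, r.right s = ∑ i, character k H H (d i * r.right s) • (b i : H) := fun s => by
    have := congrArg Subtype.val (hb ⟨r.right s, hr s⟩)
    simpa using this.symm
  have h₃ : ∀ i, ∑ s ∈ r.index, character k H H (d i * r.right s) • antipode k (r.left s) =
      character k H H t • (d i : H) := fun i => by
    rw [← antipode_dualHit_leftHit_of_mem hN ht (d i).2, dualHit_repr _ r, map_sum]
    refine Finset.sum_congr rfl fun s _ => ?_
    rw [map_smul, leftHit_apply, character_self_mul_comm]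
  apply Subtype.ext
  rw [Finset.smul_sum, AddSubmonoidClass.coe_finsetSum, OneMemClass.coe_one, ← h₁]
  have h₄ : ∀ s, antipode k (r.left s) * r.right s =
      ∑ i, (character k H H (d i * r.right s) • antipode k (r.left s)) * (b i : H) := fun s => by
    conv_lhs => rw [h₂ s]
    simp [Finset.mul_sum]
  simp only [h₄]
  rw [Finset.sum_comm]
  refine Finset.sum_congr rfl fun i _ => ?_
  rw [← Finset.sum_mul, h₃, smul_mul_assoc, SetLike.val_smul, MulMemClass.coe_mul]

omit [CharZero k] [IsSemisimpleRing H] in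
theorem inducedRelations_le_ker (c : k) (V : Type v) [AddCommGroup V] [Module k V] [Module N V]
    [IsScalarTower k N V] : inducedRelations N V ≤ ker (inducedProjection c b d V) := by
  rw [inducedRelations, Submodule.span_le]
  rintro _ ⟨h, y, v, rfl⟩
  rw [SetLike.mem_coe, mem_ker, map_sub, sub_eq_zero, inducedProjection_tmul,
    inducedProjection_tmul]
  let f : N →ₗ[k] N →ₗ[k] H ⊗[k] V :=
    (TensorProduct.mk k H V).compl₁₂ (mulLeft k h ∘ₗ N.val.toLinearMap)
      ((Algebra.lsmul k k V).toLinearMap.flip v)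
  have := sum_mul_dualBases_comm hb hd f y
  congr 1
  simpa [f, mul_assoc, mul_smul] using this

include hN

omit hd in
theorem mkQ_inducedProjection {t : H} (ht : IsIdempotentIntegral N t) (V : Type v)
    [AddCommGroup V] [Module k V] [Module N V] [IsScalarTower k N V] (m : H ⊗[k] V) :
    (inducedRelations N V).mkQ (inducedProjection (character k H H t) b d V m) =
      (inducedRelations N V).mkQ m := by
  induction m with
  | zero => simp
  | add x y hx hy => rw [map_add, map_add, map_add, hx, hy]
  | tmul h v =>
    have h₁ : ∀ y : N, ∀ w : V, (inducedRelations N V).mkQ ((h * y) ⊗ₜ w) =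
        (inducedRelations N V).mkQ (h ⊗ₜ (y • w)) := fun y w => by
      rw [← sub_eq_zero, ← map_sub]
      exact (Submodule.Quotient.mk_eq_zero _).mpr (Submodule.subset_span ⟨h, y, w, rfl⟩)
    have h₂ := sum_dualBases_mul hN hb ht
    have h₃ : character k H H t • ∑ i, (d i • b i • v) = v := by
      have := congrArg (· • v) h₂
      simpa [Finset.sum_smul, mul_smul, smul_assoc] using this
    have h₄ : ∀ z, (inducedRelations N V).mkQ (character k H H t • z) =
        character k H H t • (inducedRelations N V).mkQ z :=
      (((inducedRelations N V).mkQ).restrictScalars k).map_smul _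
    rw [inducedProjection_tmul, h₄, map_sum]
    simp only [h₁]
    rw [← map_sum, ← h₄, ← TensorProduct.tmul_sum, ← TensorProduct.tmul_smul, h₃]

theorem character_inducedModule {tN t : H} (htN : IsIdempotentIntegral N tN)
    (ht : IsIdempotentIntegral (⊤ : Subalgebra k H) t)
    (V : Type v) [AddCommGroup V] [Module k V] [Module N V] [IsScalarTower k N V]
    [Module.Finite k V] (x : H) :
    character k H (InducedModule N V) x = character k H H tN •
      ∑ i, character k H H (d i * adjointAction k t x) • character k N V (b i) := by
  have := module_finite_of_isSemisimpleRing k H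
  rw [character_quotient_eq (inducedRelations N V) (inducedProjection (character k H H tN) b d V)
    (inducedRelations_le_ker hb hd _ V) (mkQ_inducedProjection hN hb htN V)]
  have h₂ : Algebra.lsmul k k (H ⊗[k] V) x ∘ₗ
      (inducedProjection (character k H H tN) b d V).restrictScalars k =
      character k H H tN • ∑ i, TensorProduct.map (mulLeft k x ∘ₗ mulRight k (d i : H))
        (Algebra.lsmul k k V (b i)) := by
    apply TensorProduct.ext'
    intro h v
    rw [LinearMap.comp_apply, LinearMap.restrictScalars_apply, inducedProjection_tmul, map_smul,
      map_sum]
    simp [TensorProduct.smul_tmul']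
  rw [h₂, map_smul, map_sum]
  congr 1
  refine Finset.sum_congr rfl fun i _ => ?_
  rw [trace_tensorProduct', trace_mulLeft_comp_mulRight ht, character_self_mul_comm, smul_eq_mul,
    ← character_apply (a := b i)]

end Bases

theorem character_inducedModule_eq_gamma {N : Subalgebra k H} (hN : IsLeftCoideal N) {tN t : H}
    (htN : IsIdempotentIntegral N tN) (ht : IsIdempotentIntegral (⊤ : Subalgebra k H) t)
    (V : Type v) [AddCommGroup V] [Module k V] [Module N V] [IsScalarTower k N V]
    [Module.Finite k V] :
    character k H (InducedModule N V) = gamma N (leftHit tN (character k H H))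
      (dualHit_leftHit_integral_mem hN htN) (character k N V) ∘ₗ adjointAction k t := by
  obtain ⟨n, b, d, hb, hd⟩ := hN.exists_dualBases
  ext x
  rw [character_inducedModule hN hb hd htN ht, LinearMap.comp_apply, gamma_apply]
  have h : (⟨dualHit (leftHit tN (character k H H)) (adjointAction k t x),
      dualHit_leftHit_integral_mem hN htN _⟩ : N) =
      character k H H tN • ∑ i, character k H H (d i * adjointAction k t x) • b i :=
    Subtype.ext (dualHit_leftHit_integral_eq_sum hN hd htN _)
  rw [h, map_smul, map_sum]
  simp only [map_smul]

omit [CharZero k] in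
theorem module_finite_of_isSimpleModule (N : Subalgebra k H) (V : Type*) [AddCommGroup V]
    [Module k V] [Module N V] [IsScalarTower k N V] [IsSimpleModule N V] : Module.Finite k V := by
  have := module_finite_of_isSemisimpleRing k H
  exact Module.Finite.trans N V

end

theorem IsCharacterInduction.unique {N : Subalgebra k H}
    {ind ind' : charSpan N →ₗ[k] Module.Dual k H} (h : IsCharacterInduction N ind)
    (h' : IsCharacterInduction N ind') : ind = ind' := by
  apply LinearMap.ext
  rintro ⟨φ, hφ⟩
  induction hφ using Submodule.span_induction with
  | mem φ hφ =>
    obtain ⟨V, _, _, _, _, _, rfl⟩ := hφ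
    exact (h V).trans (h' V).symm
  | zero => exact (map_zero ind).trans (map_zero ind').symm
  | add φ ψ hφ hψ ih₁ ih₂ =>
    have : (⟨φ + ψ, (charSpan N).add_mem hφ hψ⟩ : charSpan N) = ⟨φ, hφ⟩ + ⟨ψ, hψ⟩ := rfl
    rw [this, map_add, map_add, ih₁, ih₂]
  | smul c φ hφ ih =>
    have : (⟨c • φ, (charSpan N).smul_mem c hφ⟩ : charSpan N) = c • ⟨φ, hφ⟩ := rfl
    rw [this, map_smul, map_smul, ih]

end Induction

end HopfInduction

open HopfInduction in
theorem mainTheorem4 {k : Type*} {H : Type*} [Field k] [CharZero k] [Ring H] [HopfAlgebra k H]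
    [IsSemisimpleRing H] (N : Subalgebra k H) (hN : IsLeftCoideal N) :
    (∃! Λ : H, IsIdempotentIntegral (⊤ : Subalgebra k H) Λ) ∧
    (∃! ΛN : H, IsIdempotentIntegral N ΛN) ∧
    (∃! ind : charSpan N →ₗ[k] Module.Dual k H, IsCharacterInduction N ind) ∧
    ∀ (Λ ΛN : H), IsIdempotentIntegral (⊤ : Subalgebra k H) Λ → IsIdempotentIntegral N ΛN →
      ∀ ind : charSpan N →ₗ[k] Module.Dual k H, IsCharacterInduction N ind →
      ∀ lamB : Module.Dual k H, lamB = leftHit ΛN (character k H H) →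
        IsDualIntegral (dualInvariants N) lamB ∧
        ∃ hB : ∀ h : H, dualHit lamB h ∈ N,
          ∀ φ : charSpan N, ind φ = coad Λ (gamma N lamB hB φ) := by
  obtain ⟨t, ht⟩ := exists_isIdempotentIntegral_top k H
  obtain ⟨tN, htN⟩ := hN.exists_isIdempotentIntegral
  -- The right-hand side of the formula is linear on all of N^*, so its restriction to R(N) is the
  -- induction map; no linear independence of irreducible characters is needed.
  let ind₀ : ∀ (Λ ΛN : H), IsIdempotentIntegral N ΛN → (charSpan N →ₗ[k] Module.Dual k H) :=
    fun Λ ΛN hΛN => Module.Dual.transpose (R := k) (adjointAction k Λ) ∘ₗ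
      gamma N (leftHit ΛN (character k H H)) (dualHit_leftHit_integral_mem hN hΛN) ∘ₗ
      (charSpan N).subtype
  have hind₀ : ∀ Λ ΛN (_ : IsIdempotentIntegral (⊤ : Subalgebra k H) Λ)
      (hΛN : IsIdempotentIntegral N ΛN), IsCharacterInduction N (ind₀ Λ ΛN hΛN) := by
    intro Λ ΛN hΛ hΛN V _ _ _ _ _
    have := module_finite_of_isSimpleModule N V
    exact (character_inducedModule_eq_gamma hN hΛN hΛ V).symm
  refine ⟨⟨t, ht, fun s hs => hs.unique ht⟩, ⟨tN, htN, fun s hs => hs.unique htN⟩,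
    ⟨ind₀ t tN htN, hind₀ t tN ht htN, fun ind hind => hind.unique (hind₀ t tN ht htN)⟩, ?_⟩
  rintro Λ ΛN hΛ hΛN ind hind _ rfl
  refine ⟨isDualIntegral_leftHit_integral hN hΛN, dualHit_leftHit_integral_mem hN hΛN,
    fun φ => ?_⟩
  rw [hind.unique (hind₀ Λ ΛN hΛ hΛN), coad_eq_comp_adjointAction]
  rfl
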